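/- Let $u, K : \mathbb{R}^2 \to \mathbb{R}$ be smooth ($C^\infty$) functions satisfying $$-\Delta u = K e^{2u} \quad \text{on } \mathbb{R}^2,$$ with $Ke^{2u} \in L^1(\mathbb{R}^2)$ and $e^{2u} \in L^1(\mathbb{R}^2)$. Suppose that $x\cdot\nabla K(x) \ge 0$ for every $x \in \mathbb{R}^2$ and that $K$ is non-negative near infinity, i.e. there is $R \in \mathbb{R}$ such that $K(x) \ge 0$ whenever $|x| \ge R$. Then $$\int_{\mathbb{R}^2} K e^{2u}\,\mathrm{d}x \ge 4\pi,$$ and equality holds if and only if $K$ is a positive constant. -/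

import Mathlib

open MeasureTheory
open scoped ContDiff Laplacian Gradient

/-! Write `Λ` for the total curvature `∫ K e^{2u}`. The equation is tested against `V_R · ∇u`, where
`V_R` is the field `x` cut off at scale `R`. Since `K e^{2u} ∂ᵢu = ½ K ∂ᵢ(e^{2u})`, integration by
parts turns `∫ Δu V_R · ∇u` into `½ ∫ div(K V_R) e^{2u}`, and `div(K V_R)` is a cut-off form of `x ·
∇K + 2K` (`sum_integral_cutField_eq`).

The same quantity has a second expression. Finite volume excludes a harmonic remainder in `∇u`,
leaving `2π ∇u(x) = ∫ (x - z)/|x - z|² Δu(z) dz`; this appears in mollified form in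
`integral_kern_mul_laplacian`. Symmetrizing the resulting double integral in `x` and `z` replaces
the singular kernel by `⟪V x - V z, x - z⟫/|x - z|²`, which is bounded uniformly in `R` and tends to
`1` off the diagonal. The limit is therefore `Λ²/(4π)` (`tendsto_sum_integral_cutField`).

Equating the two, `Λ(Λ - 4π)/(2π)` is the limit of the cut-off integrals of `x · ∇K e^{2u}`, hence
non-negative. Moreover `Λ > 0` (`integral_neg_laplacian_pos`): otherwise averages of `u` over large
discs could not decay like `-log r`, as finite volume demands. So `Λ ≥ 4π`. Equality forces `x · ∇K
= 0`, so `K` is constant along rays from the origin and thus constant, positive because `Λ > 0`;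
conversely, a constant `K` makes `Λ(Λ - 4π)` vanish. -/

/-- The Euclidean plane. -/
abbrev Plane := EuclideanSpace ℝ (Fin 2)

/-! ### Coordinate derivatives and the Laplacian -/

/-- The partial derivative in the `i`-th coordinate direction. -/
noncomputable def pd (i : Fin 2) (g : Plane → ℝ) (x : Plane) : ℝ :=
  fderiv ℝ g x (EuclideanSpace.single i 1)

theorem ContDiff.pd {g : Plane → ℝ} (hg : ContDiff ℝ ∞ g) (i : Fin 2) :
    ContDiff ℝ ∞ (pd i g) :=
  (hg.fderiv_right (m := ∞) (by simp)).clm_apply contDiff_const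

theorem ContDiff.continuous_pd {g : Plane → ℝ} {n : ℕ∞ω} (hg : ContDiff ℝ n g) (hn : n ≠ 0)
    (i : Fin 2) : Continuous (_root_.pd i g) :=
  (hg.continuous_fderiv hn).clm_apply continuous_const

theorem fderiv_apply_eq_sum_pd (g : Plane → ℝ) (x v : Plane) :
    fderiv ℝ g x v = ∑ i, v i * pd i g x := by
  have : v = ∑ i, v i • EuclideanSpace.single i (1 : ℝ) := by
    ext j; fin_cases j <;> simp
  conv_lhs => rw [this]
  simp [pd]

theorem inner_gradient_eq_sum_pd (g : Plane → ℝ) (x v : Plane) :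
    inner ℝ v (∇ g x) = ∑ i, v i * pd i g x := by
  rw [← fderiv_apply_eq_sum_pd, real_inner_comm, gradient, InnerProductSpace.toDual_symm_apply]

theorem pd_pd {g : Plane → ℝ} (hg : ContDiff ℝ ∞ g) (i j : Fin 2) (x : Plane) :
    pd i (pd j g) x =
      fderiv ℝ (fderiv ℝ g) x (EuclideanSpace.single i 1) (EuclideanSpace.single j 1) := by
  have h : DifferentiableAt ℝ (fderiv ℝ g) x :=
    (hg.fderiv_right (m := ∞) (by simp)).differentiable (by simp) x
  unfold pd
  rw [fderiv_clm_apply h (differentiableAt_const _)]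
  simp

theorem pd_comm {g : Plane → ℝ} (hg : ContDiff ℝ ∞ g) (i j : Fin 2) (x : Plane) :
    pd i (pd j g) x = pd j (pd i g) x := by
  rw [pd_pd hg, pd_pd hg]
  exact (hg.contDiffAt.isSymmSndFDerivAt
    (by simpa using WithTop.coe_le_coe.2 (le_top (a := (2 : ℕ∞))))).eq _ _

theorem laplacian_eq_sum_pd {g : Plane → ℝ} (hg : ContDiff ℝ ∞ g) (x : Plane) :
    Δ g x = ∑ i, pd i (pd i g) x := by
  rw [InnerProductSpace.laplacian_eq_iteratedFDeriv_orthonormalBasis g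
    (EuclideanSpace.basisFun (Fin 2) ℝ)]
  refine Finset.sum_congr rfl fun i _ => ?_
  rw [pd_pd hg, iteratedFDeriv_two_apply]
  simp

theorem ContDiff.laplacian_plane {g : Plane → ℝ} (hg : ContDiff ℝ ∞ g) :
    ContDiff ℝ ∞ (Δ g) := by
  have : Δ g = fun x => ∑ i, _root_.pd i (_root_.pd i g) x := funext (laplacian_eq_sum_pd hg)
  rw [this]
  exact ContDiff.sum fun i _ => (hg.pd i).pd i

/-! ### Integration by parts with radial test functions -/

/-- Integration by parts against a compactly supported function. -/
theorem integral_mul_pd {F G : Plane → ℝ} (hF : ContDiff ℝ 1 F) (hc : HasCompactSupport F)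
    (hG : ContDiff ℝ 1 G) (i : Fin 2) :
    ∫ x, F x * pd i G x = - ∫ x, pd i F x * G x := by
  have h1 : HasCompactSupport (pd i F) := by
    refine (hc.fderiv (𝕜 := ℝ)).mono fun x hx => ?_
    contrapose! hx
    simp only [Function.mem_support, not_not] at hx
    simp [pd, hx]
  refine integral_mul_fderiv_eq_neg_fderiv_mul_of_integrable ?_ ?_ ?_ ?_ ?_
  · exact ((hF.continuous_pd one_ne_zero i).mul hG.continuous).integrable_of_hasCompactSupport
      h1.mul_right
  · exact (hF.continuous.mul (hG.continuous_pd one_ne_zero i)).integrable_of_hasCompactSupport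
      hc.mul_right
  · exact (hF.continuous.mul hG.continuous).integrable_of_hasCompactSupport hc.mul_right
  · exact fun x _ => hF.differentiable one_ne_zero x
  · exact fun x _ => hG.differentiable one_ne_zero x

theorem hasCompactSupport_radial {q : ℝ → ℝ} {S : ℝ} (hq : ∀ s, S ≤ s → q s = 0) :
    HasCompactSupport (fun y : Plane => q (‖y‖ ^ 2)) := by
  refine HasCompactSupport.intro (isCompact_closedBall 0 (|S| + 1)) fun x hx => hq _ ?_
  simp only [Metric.mem_closedBall, dist_zero_right, not_le] at hx
  nlinarith [le_abs_self S, abs_nonneg S]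

theorem contDiff_radial {q : ℝ → ℝ} {n : ℕ∞ω} (hq : ContDiff ℝ n q) :
    ContDiff ℝ n (fun y : Plane => q (‖y‖ ^ 2)) :=
  hq.comp (contDiff_norm_sq ℝ)

theorem pd_radial {q : ℝ → ℝ} (hq : ContDiff ℝ 1 q) (i : Fin 2) (y : Plane) :
    pd i (fun y => q (‖y‖ ^ 2)) y = 2 * deriv q (‖y‖ ^ 2) * y i := by
  have h1 : HasFDerivAt (fun y : Plane => ‖y‖ ^ 2) (2 • (innerSL ℝ y)) y :=
    (hasStrictFDerivAt_norm_sq y).hasFDerivAt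
  have h2 := ((hq.differentiable one_ne_zero (‖y‖ ^ 2)).hasDerivAt.comp_hasFDerivAt y h1).fderiv
  unfold pd
  rw [show (fun y : Plane => q (‖y‖ ^ 2)) = q ∘ fun y : Plane => ‖y‖ ^ 2 from rfl, h2]
  simp [EuclideanSpace.inner_single_right]
  ring

theorem contDiff_coord {n : ℕ∞ω} (i : Fin 2) : ContDiff ℝ n (fun y : Plane => y i) :=
  (EuclideanSpace.proj (𝕜 := ℝ) i).contDiff

theorem pd_mul {F G : Plane → ℝ} {x : Plane} (hF : DifferentiableAt ℝ F x)
    (hG : DifferentiableAt ℝ G x) (i : Fin 2) :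
    pd i (fun y => F y * G y) x = F x * pd i G x + pd i F x * G x := by
  unfold pd
  rw [fderiv_fun_mul hF hG]
  simp [mul_comm]

theorem pd_coord (i j : Fin 2) (x : Plane) :
    pd i (fun y => y j) x = if i = j then 1 else 0 := by
  unfold pd
  rw [show (fun y : Plane => y j) =
    (EuclideanSpace.proj (𝕜 := ℝ) j) from rfl,
    ContinuousLinearMap.fderiv]
  simp [eq_comm]

theorem pd_radial_mul_coord {q : ℝ → ℝ} (hq : ContDiff ℝ 1 q) (i j : Fin 2) (y : Plane) :
    pd i (fun y => q (‖y‖ ^ 2) * y j) y =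
      q (‖y‖ ^ 2) * (if i = j then 1 else 0) + 2 * deriv q (‖y‖ ^ 2) * y i * y j := by
  rw [pd_mul ((contDiff_radial hq).differentiable one_ne_zero y)
    ((contDiff_coord (n := 1) j).differentiable one_ne_zero y), pd_coord, pd_radial hq]

theorem sq_norm_plane (y : Plane) : ‖y‖ ^ 2 = y 0 * y 0 + y 1 * y 1 := by
  rw [EuclideanSpace.norm_sq_eq]; simp [Fin.sum_univ_two, sq]

theorem integral_radial_mul_pd {p : ℝ → ℝ} {S : ℝ} (hp : ContDiff ℝ 1 p)
    (hS : ∀ s, S ≤ s → p s = 0) {w : Plane → ℝ} (hw : ContDiff ℝ 1 w) (i : Fin 2) :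
    ∫ y, p (‖y‖ ^ 2) * pd i w y = -∫ y, 2 * deriv p (‖y‖ ^ 2) * y i * w y := by
  rw [integral_mul_pd (contDiff_radial hp) (hasCompactSupport_radial hS) hw]
  simp_rw [pd_radial hp]

theorem deriv_eq_zero_of_eq_const {p : ℝ → ℝ} {c S S' : ℝ} (hS : ∀ s, S ≤ s → p s = c)
    (hS' : S < S') (s : ℝ) (hs : S' ≤ s) : deriv p s = 0 := by
  have : p =ᶠ[nhds s] fun _ => c := by
    filter_upwards [lt_mem_nhds (hS'.trans_le hs)] with t ht using hS t ht.le
  rw [this.deriv_eq]; simp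

/-- Green's formula for a radial test function. -/
theorem integral_radial_mul_laplacian {p : ℝ → ℝ} {S : ℝ} (hp : ContDiff ℝ 1 p)
    (hS : ∀ s, S ≤ s → p s = 0) {w : Plane → ℝ} (hw : ContDiff ℝ ∞ w) :
    ∫ y, p (‖y‖ ^ 2) * Δ w y = -∫ y, 2 * deriv p (‖y‖ ^ 2) * fderiv ℝ w y y := by
  have hc := hasCompactSupport_radial hS
  have hc' : HasCompactSupport (fun y : Plane => 2 * deriv p (‖y‖ ^ 2)) :=
    (hasCompactSupport_radial (deriv_eq_zero_of_eq_const hS (lt_add_one S))).mul_left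
  have hp' : Continuous fun y : Plane => 2 * deriv p (‖y‖ ^ 2) :=
    continuous_const.mul ((hp.continuous_deriv le_rfl).comp (by fun_prop))
  have hi : ∀ i : Fin 2, Integrable (fun y : Plane => p (‖y‖ ^ 2) * pd i (pd i w) y) := fun i =>
    ((contDiff_radial hp).continuous.mul
      ((hw.pd i).pd i).continuous).integrable_of_hasCompactSupport hc.mul_right
  have hi' : ∀ i : Fin 2, Integrable
      (fun y : Plane => 2 * deriv p (‖y‖ ^ 2) * y i * pd i w y) := fun i =>
    ((hp'.mul (contDiff_coord (n := 0) i).continuous).mul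
      (hw.pd i).continuous).integrable_of_hasCompactSupport hc'.mul_right.mul_right
  simp_rw [laplacian_eq_sum_pd hw, fderiv_apply_eq_sum_pd, Finset.mul_sum, ← mul_assoc]
  rw [integral_finsetSum _ fun i _ => hi i, integral_finsetSum _ fun i _ => hi' i,
    ← Finset.sum_neg_distrib]
  exact Finset.sum_congr rfl fun i _ =>
    integral_radial_mul_pd hp hS ((hw.pd i).of_le (by simp)) i

/-- Integration by parts of the Laplacian against a curl-free radial vector field. -/
theorem integral_radial_mul_coord_mul_laplacian {q : ℝ → ℝ} {S : ℝ} (hq : ContDiff ℝ 1 q)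
    (hS : ∀ s, S ≤ s → q s = 0) {w : Plane → ℝ} (hw : ContDiff ℝ ∞ w) (i : Fin 2) :
    ∫ y, q (‖y‖ ^ 2) * y i * Δ w y =
      -∫ y, (2 * q (‖y‖ ^ 2) + 2 * ‖y‖ ^ 2 * deriv q (‖y‖ ^ 2)) * pd i w y := by
  set κ : Fin 2 → Plane → ℝ := fun j y => q (‖y‖ ^ 2) * y j with hκ
  have hc : ∀ j, HasCompactSupport (κ j) := fun j => (hasCompactSupport_radial hS).mul_right
  have hκ1 : ∀ j, ContDiff ℝ 1 (κ j) := fun j => (contDiff_radial hq).mul (contDiff_coord j)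
  have hpd : ∀ i j, HasCompactSupport (pd i (κ j)) := fun i j => by
    refine ((hc j).fderiv (𝕜 := ℝ)).mono fun x hx => ?_
    contrapose! hx
    simp only [Function.mem_support, not_not] at hx
    simp [pd, hx]
  have h1 : ∀ a b c, Integrable (fun y => κ a y * pd b (pd c w) y) := fun a b c =>
    ((hκ1 a).continuous.mul ((hw.pd c).pd b).continuous).integrable_of_hasCompactSupport
      (hc a).mul_right
  have h2 : ∀ a b c, Integrable (fun y => pd a (κ b) y * pd c w y) := fun a b c =>
    (((hκ1 b).continuous_pd one_ne_zero a).mul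
      (hw.pd c).continuous).integrable_of_hasCompactSupport (hpd a b).mul_right
  have hw1 : ∀ j, ContDiff ℝ 1 (pd j w) := fun j => (hw.pd j).of_le (by simp)
  have hκpd : ∀ a b y, pd a (κ b) y = q (‖y‖ ^ 2) * (if a = b then 1 else 0) +
      2 * deriv q (‖y‖ ^ 2) * y a * y b := fun a b y => pd_radial_mul_coord hq a b y
  have hsymm : ∀ a b y, pd a (κ b) y = pd b (κ a) y := fun a b y => by
    rw [hκpd, hκpd]
    simp only [eq_comm (a := a)]
    ring
  calc ∫ y, q (‖y‖ ^ 2) * y i * Δ w y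
      = ∑ j, ∫ y, κ i y * pd j (pd j w) y := by
        rw [← integral_finsetSum _ fun j _ => h1 i j j]
        simp_rw [laplacian_eq_sum_pd hw, Finset.mul_sum, hκ]
    -- Two integrations by parts around the curl-free identity `∂ⱼκᵢ = ∂ᵢκⱼ` exchange the indices;
    -- the sum over `j` then collapses to the divergence of `κ`.
    _ = ∑ j, ∫ y, κ j y * pd i (pd j w) y := by
        refine Finset.sum_congr rfl fun j _ => ?_
        rw [integral_mul_pd (hκ1 i) (hc i) (hw1 j), integral_mul_pd (hκ1 j) (hc j) (hw1 j)]
        simp_rw [hsymm j i]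
    _ = ∑ j, -∫ y, pd j (κ j) y * pd i w y := by
        refine Finset.sum_congr rfl fun j _ => ?_
        simp_rw [pd_comm hw i j]
        rw [integral_mul_pd (hκ1 j) (hc j) (hw1 i)]
    _ = _ := by
        rw [Finset.sum_neg_distrib, ← integral_finsetSum _ fun j _ => h2 j j i]
        congr 1
        refine integral_congr_ae (.of_forall fun y => ?_)
        simp only [hκpd, Fin.sum_univ_two, sq_norm_plane, if_true]
        ring

/-! ### Dilated averages and their derivative in the scale -/

theorem contDiff_comp_affine {g : Plane → ℝ} {n : ℕ∞ω} (hg : ContDiff ℝ n g) (x : Plane) (r : ℝ) :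
    ContDiff ℝ n (fun y => g (x + r • y)) :=
  hg.comp (contDiff_const.add (contDiff_id.const_smul r))

theorem fderiv_comp_affine {g : Plane → ℝ} (hg : Differentiable ℝ g) (x : Plane) (r : ℝ)
    (y v : Plane) : fderiv ℝ (fun y => g (x + r • y)) y v = r * fderiv ℝ g (x + r • y) v := by
  have h1 : HasFDerivAt (fun y : Plane => x + r • y) (r • ContinuousLinearMap.id ℝ Plane) y :=
    ((hasFDerivAt_id y).const_smul r).const_add x
  have h2 := ((hg (x + r • y)).hasFDerivAt.comp y h1).fderiv
  rw [show (fun y => g (x + r • y)) = g ∘ fun y => x + r • y from rfl, h2]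
  simp

theorem laplacian_comp_affine {g : Plane → ℝ} (hg : ContDiff ℝ ∞ g) (x : Plane) (r : ℝ)
    (y : Plane) : Δ (fun y => g (x + r • y)) y = r ^ 2 * Δ g (x + r • y) := by
  have h1 : ∀ i, pd i (fun y => g (x + r • y)) = fun y => r * pd i g (x + r • y) := fun i =>
    funext fun y => fderiv_comp_affine (hg.differentiable (by simp)) x r y _
  have h2 : ∀ i, pd i (fun y => r * pd i g (x + r • y)) y = r * (r * pd i (pd i g) (x + r • y)) := by
    intro i
    have h3 : DifferentiableAt ℝ (fun y => pd i g (x + r • y)) y :=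
      (contDiff_comp_affine (hg.pd i) x r).differentiable (by simp) y
    rw [← show pd i (fun y => pd i g (x + r • y)) y = r * pd i (pd i g) (x + r • y) from
      fderiv_comp_affine ((hg.pd i).differentiable (by simp)) x r y _]
    unfold pd at h3 ⊢
    rw [fderiv_const_mul h3]
    simp
  rw [laplacian_eq_sum_pd (contDiff_comp_affine hg x r), laplacian_eq_sum_pd hg]
  simp_rw [h1, h2]
  simp [Fin.sum_univ_two]
  ring

/-- The derivative in `r` of a weighted average of `u` over the dilates by `r` of a radial
profile. -/
theorem hasDerivAt_integral_radial {p : ℝ → ℝ} {S : ℝ} (hp : ContDiff ℝ 1 p)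
    (hS : ∀ s, S ≤ s → p s = 0) {u : Plane → ℝ} (hu : ContDiff ℝ ∞ u) {r : ℝ} (hr : 0 < r) :
    HasDerivAt (fun r => ∫ y : Plane, (-2 * deriv p (‖y‖ ^ 2)) * u (r • y))
      (r * ∫ y : Plane, p (‖y‖ ^ 2) * Δ u (r • y)) r := by
  set W : Plane → ℝ := fun y => -2 * deriv p (‖y‖ ^ 2) with hW
  have hWc : HasCompactSupport W :=
    (hasCompactSupport_radial (deriv_eq_zero_of_eq_const hS (lt_add_one S))).mul_left
  have hW0 : Continuous W :=
    continuous_const.mul ((hp.continuous_deriv le_rfl).comp (by fun_prop))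
  have hdu : Continuous (fderiv ℝ u) := hu.continuous_fderiv (by simp)
  have hcont : Continuous fun z : ℝ × Plane => fderiv ℝ u (z.1 • z.2) z.2 :=
    (hdu.comp (by fun_prop)).clm_apply continuous_snd
  obtain ⟨C, hC⟩ := ((isCompact_Icc (a := r - 1) (b := r + 1)).prod hWc).exists_bound_of_continuousOn
    hcont.continuousOn
  have key := hasDerivAt_integral_of_dominated_loc_of_deriv_le
    (F := fun r y => W y * u (r • y)) (F' := fun r y => W y * fderiv ℝ u (r • y) y)
    (bound := fun y => ‖W y‖ * C) (μ := (volume : Measure Plane)) (x₀ := r)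
    (s := Metric.ball r 1) (Metric.ball_mem_nhds r one_pos)
    (.of_forall fun t => (hW0.mul (hu.continuous.comp (by fun_prop))).aestronglyMeasurable)
    ((hW0.mul (hu.continuous.comp (by fun_prop))).integrable_of_hasCompactSupport hWc.mul_right)
    (hW0.mul ((hdu.comp (by fun_prop)).clm_apply continuous_id)).aestronglyMeasurable
    (.of_forall fun y t ht => by
      rw [norm_mul]
      by_cases hy : y ∈ tsupport W
      · refine mul_le_mul_of_nonneg_left (hC (t, y) ⟨?_, hy⟩) (norm_nonneg _)
        rw [Metric.mem_ball, Real.dist_eq, abs_lt] at ht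
        constructor <;> linarith
      · rw [image_eq_zero_of_notMem_tsupport hy]; simp)
    ((hW0.norm.mul continuous_const).integrable_of_hasCompactSupport hWc.norm.mul_right)
    (.of_forall fun y t ht => by
      have h1 : HasDerivAt (fun t : ℝ => t • y) y t := by
        simpa using (hasDerivAt_id t).smul_const y
      exact (((hu.differentiable (by simp)) (t • y)).hasFDerivAt.comp_hasDerivAt t h1).const_mul _)
  have h2 := integral_radial_mul_laplacian hp hS (contDiff_comp_affine hu 0 r)
  simp_rw [laplacian_comp_affine hu, fderiv_comp_affine (hu.differentiable (by simp)), zero_add]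
    at h2
  -- Green's formula for the dilate `u (r • ·)` carries `r²` on the Laplacian side and `r` on the
  -- gradient side; one factor `r` is cancelled.
  refine key.2.congr_deriv ?_
  simp_rw [show ∀ y : Plane, p (‖y‖ ^ 2) * (r ^ 2 * Δ u (r • y)) =
    r ^ 2 * (p (‖y‖ ^ 2) * Δ u (r • y)) from fun y => by ring,
    show ∀ y : Plane, 2 * deriv p (‖y‖ ^ 2) * (r * fderiv ℝ u (r • y) y) =
    (-r) * (W y * fderiv ℝ u (r • y) y) from fun y => by simp only [hW]; ring] at h2
  rw [integral_const_mul, integral_const_mul] at h2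
  have : r * (r * (∫ y : Plane, p (‖y‖ ^ 2) * Δ u (r • y)) -
    ∫ y, W y * fderiv ℝ u (r • y) y) = 0 := by linarith
  rcases mul_eq_zero.1 this with h | h
  · exact absurd h hr.ne'
  · linarith

theorem integral_comp_smul_plane (g : Plane → ℝ) {r : ℝ} (hr : 0 < r) :
    r ^ 2 * ∫ y : Plane, g (r • y) = ∫ y, g y := by
  rw [Measure.integral_comp_smul]
  have : 0 < r ^ 2 := by positivity
  simp
  field_simp

/-- The function `g + c log` is nondecreasing on `[a, ∞)`, because `r` times its derivative is `r g'
+ c ≥ 0`. -/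
theorem sub_mul_log_le {g g' : ℝ → ℝ} {a c : ℝ} (ha : 0 < a)
    (h : ∀ r, a ≤ r → HasDerivAt g (g' r) r) (h' : ∀ r, a ≤ r → -c ≤ r * g' r) {r : ℝ}
    (hr : a ≤ r) : g a - c * (Real.log r - Real.log a) ≤ g r := by
  have hd : ∀ t, a ≤ t → HasDerivAt (fun t => g t + c * Real.log t) (g' t + c * t⁻¹) t :=
    fun t ht => (h t ht).add ((Real.hasDerivAt_log (ha.trans_le ht).ne').const_mul c)
  have hmono : MonotoneOn (fun t => g t + c * Real.log t) (Set.Ici a) := by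
    refine monotoneOn_of_deriv_nonneg (convex_Ici a)
      (fun t ht => (hd t ht).continuousAt.continuousWithinAt)
      (fun t ht => (hd t (interior_subset ht)).differentiableAt.differentiableWithinAt)
      fun t ht => ?_
    have ht' : a ≤ t := interior_subset ht
    have htpos := ha.trans_le ht'
    rw [(hd t ht').deriv]
    have := h' t ht'
    have h3 : g' t + c * t⁻¹ = (t * g' t + c) * t⁻¹ := by field_simp
    rw [h3]
    exact mul_nonneg (by linarith) (inv_nonneg.2 htpos.le)
  have := hmono (Set.mem_Ici.2 le_rfl) (Set.mem_Ici.2 hr) hr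
  linarith

/-! ### Logarithmic control of disc averages -/

/-- A compactly supported cut-off profile of class `C¹`. -/
noncomputable def cutoffSq (s : ℝ) : ℝ := max 0 (3 - s) ^ 2

theorem hasDerivAt_cutoffSq (s : ℝ) : HasDerivAt cutoffSq (-2 * max 0 (3 - s)) s := by
  rcases lt_trichotomy s 3 with h | h | h
  · have h1 : cutoffSq =ᶠ[nhds s] fun s => (3 - s) ^ 2 := by
      filter_upwards [gt_mem_nhds h] with t ht
      rw [cutoffSq, max_eq_right (by linarith)]
    rw [max_eq_right (by linarith)]
    refine HasDerivAt.congr_of_eventuallyEq ?_ h1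
    exact (((hasDerivAt_id' s).const_sub 3).fun_pow 2).congr_deriv (by norm_num)
  -- At the corner the error is at most `(t - 3)²`, which is `o(t - 3)`.
  · subst h
    rw [hasDerivAt_iff_isLittleO]
    have h2 : (fun t : ℝ => (t - 3) ^ 2) =o[nhds 3] fun t => t - 3 := by
      refine Asymptotics.IsLittleO.comp_tendsto (g := fun t : ℝ => t)
        (f := fun t : ℝ => t ^ 2) (l := nhds 0) (Asymptotics.isLittleO_pow_id one_lt_two) ?_
      exact Continuous.tendsto' (by fun_prop) _ _ (by simp)
    refine (Asymptotics.IsBigO.of_bound 1 (.of_forall fun t => ?_)).trans_isLittleO h2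
    simp only [cutoffSq, sub_self, max_self, mul_zero, smul_zero, sub_zero, one_mul, norm_pow,
      Real.norm_eq_abs, sq_abs]
    rcases le_total t 3 with h | h
    · rw [max_eq_right (by linarith), show (3 - t) ^ 2 - 0 ^ 2 = (t - 3) ^ 2 by ring,
        abs_of_nonneg (sq_nonneg _)]
    · rw [max_eq_left (by linarith)]
      simpa using sq_nonneg (t - 3)
  · have h1 : cutoffSq =ᶠ[nhds s] fun _ => 0 := by
      filter_upwards [lt_mem_nhds h] with t ht
      rw [cutoffSq, max_eq_left (by linarith)]; simp
    rw [max_eq_left (by linarith), mul_zero]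
    exact (hasDerivAt_const s 0).congr_of_eventuallyEq h1

theorem deriv_cutoffSq (s : ℝ) : deriv cutoffSq s = -2 * max 0 (3 - s) :=
  (hasDerivAt_cutoffSq s).deriv

theorem contDiff_cutoffSq : ContDiff ℝ 1 cutoffSq := by
  rw [contDiff_one_iff_deriv]
  refine ⟨fun s => (hasDerivAt_cutoffSq s).differentiableAt, ?_⟩
  rw [show deriv cutoffSq = fun s => -2 * max 0 (3 - s) from funext deriv_cutoffSq]
  fun_prop

theorem cutoffSq_eq_zero (s : ℝ) (hs : 3 ≤ s) : cutoffSq s = 0 := by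
  rw [cutoffSq, max_eq_left (by linarith)]; simp

theorem cutoffSq_nonneg (s : ℝ) : 0 ≤ cutoffSq s := sq_nonneg _

theorem cutoffSq_le {s : ℝ} (hs : 0 ≤ s) : cutoffSq s ≤ 9 := by
  have h1 : max 0 (3 - s) ≤ 3 := max_le (by norm_num) (by linarith)
  have h2 : 0 ≤ max 0 (3 - s) := le_max_left _ _
  unfold cutoffSq; nlinarith

/-- The radial weight `-2 * deriv cutoffSq (‖y‖ ^ 2)`. -/
noncomputable def discWeight (y : Plane) : ℝ := 4 * max 0 (3 - ‖y‖ ^ 2)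

theorem discWeight_eq (y : Plane) : discWeight y = -2 * deriv cutoffSq (‖y‖ ^ 2) := by
  rw [deriv_cutoffSq, discWeight]; ring

theorem continuous_discWeight : Continuous discWeight := by unfold discWeight; fun_prop

theorem discWeight_nonneg (y : Plane) : 0 ≤ discWeight y := by
  unfold discWeight; positivity

theorem discWeight_le (y : Plane) : discWeight y ≤ 12 := by
  have : max 0 (3 - ‖y‖ ^ 2) ≤ 3 := max_le (by norm_num) (by nlinarith [sq_nonneg ‖y‖])
  unfold discWeight; linarith

theorem four_le_discWeight {y : Plane} (hy : ‖y‖ ^ 2 ≤ 2) : 4 ≤ discWeight y := by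
  have : 3 - ‖y‖ ^ 2 ≤ max 0 (3 - ‖y‖ ^ 2) := le_max_right _ _
  unfold discWeight; linarith

theorem hasCompactSupport_discWeight : HasCompactSupport discWeight := by
  have : HasCompactSupport fun y : Plane => (fun s => 4 * max 0 (3 - s)) (‖y‖ ^ 2) :=
    hasCompactSupport_radial (q := fun s => 4 * max 0 (3 - s)) (S := 3) fun s hs => by
      simp [max_eq_left (show 3 - s ≤ 0 by linarith)]
  exact this

theorem integral_discWeight_pos : 0 < ∫ y, discWeight y := by
  have h0 : (0 : ℝ) < discWeight 0 := by
    have := four_le_discWeight (y := 0) (by simp)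
    linarith
  exact continuous_discWeight.integral_pos_of_hasCompactSupport_nonneg_nonzero
    hasCompactSupport_discWeight discWeight_nonneg h0.ne'

/-- The weighted integral of `u` over the dilated disc. -/
noncomputable def discInt (u : Plane → ℝ) (r : ℝ) : ℝ := ∫ y, discWeight y * u (r • y)

theorem hasDerivAt_discInt {u : Plane → ℝ} (hu : ContDiff ℝ ∞ u) {r : ℝ} (hr : 0 < r) :
    HasDerivAt (discInt u) (r * ∫ y : Plane, cutoffSq (‖y‖ ^ 2) * Δ u (r • y)) r := by
  have := hasDerivAt_integral_radial contDiff_cutoffSq cutoffSq_eq_zero hu hr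
  simp_rw [← discWeight_eq] at this
  exact this

theorem mul_deriv_discInt (u : Plane → ℝ) {r : ℝ} (hr : 0 < r) :
    r * (r * ∫ y : Plane, cutoffSq (‖y‖ ^ 2) * Δ u (r • y)) =
      ∫ y : Plane, cutoffSq (‖r⁻¹ • y‖ ^ 2) * Δ u y := by
  rw [← integral_comp_smul_plane (fun y => cutoffSq (‖r⁻¹ • y‖ ^ 2) * Δ u y) hr, ← mul_assoc, sq]
  simp_rw [smul_smul, inv_mul_cancel₀ hr.ne', one_smul]

theorem abs_integral_cutoffSq_mul_le {g : Plane → ℝ} (hg : Integrable g) (r : ℝ) :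
    |∫ y : Plane, cutoffSq (‖r • y‖ ^ 2) * g y| ≤ 9 * ∫ y, |g y| := by
  rw [← integral_const_mul, ← Real.norm_eq_abs]
  refine norm_integral_le_of_norm_le (hg.abs.const_mul 9) (.of_forall fun y => ?_)
  rw [norm_mul, Real.norm_eq_abs, Real.norm_eq_abs, abs_of_nonneg (cutoffSq_nonneg _)]
  exact mul_le_mul_of_nonneg_right (cutoffSq_le (by positivity)) (abs_nonneg _)

/-- On the logarithmic scale the derivative of the average is a cut-off integral of `Δ u`, with
cut-off at most `9`, so the average falls at most logarithmically. -/
theorem discInt_lower_bound {u : Plane → ℝ} (hu : ContDiff ℝ ∞ u) (hΔ : Integrable (Δ u))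
    {r : ℝ} (hr : 1 ≤ r) : discInt u 1 - (9 * ∫ y, |Δ u y|) * Real.log r ≤ discInt u r := by
  have := sub_mul_log_le one_pos (fun r hr => hasDerivAt_discInt hu (one_pos.trans_le hr))
    (c := 9 * ∫ y, |Δ u y|) (fun r hr => ?_) hr
  · simpa using this
  · rw [mul_deriv_discInt u (one_pos.trans_le hr)]
    exact neg_le_of_abs_le (abs_integral_cutoffSq_mul_le hΔ _)

theorem integrable_discWeight_mul {g : Plane → ℝ} (hg : Continuous g) :
    Integrable fun y => discWeight y * g y :=
  (continuous_discWeight.mul hg).integrable_of_hasCompactSupport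
    hasCompactSupport_discWeight.mul_right

theorem integral_discWeight_mul_exp_le {u : Plane → ℝ} (hu : Continuous u)
    (hexp : Integrable fun y => Real.exp (2 * u y)) {r : ℝ} (hr : 0 < r) :
    r ^ 2 * ∫ y : Plane, discWeight y * Real.exp (2 * u (r • y)) ≤
      12 * ∫ y, Real.exp (2 * u y) := by
  rw [← integral_comp_smul_plane (fun y => Real.exp (2 * u y)) hr, mul_left_comm]
  refine mul_le_mul_of_nonneg_left ?_ (by positivity)
  rw [← integral_const_mul]
  refine integral_mono (integrable_discWeight_mul (by fun_prop))
    ((hexp.comp_smul hr.ne').const_mul 12) fun y => ?_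
  exact mul_le_mul_of_nonneg_right (discWeight_le y) (Real.exp_pos _).le

/-- The tangent line bound `1 + t ≤ e^t` at `t = 2u(r y) + 2 log r` plays the role of Jensen's
inequality; the term `2 log r` absorbs the Jacobian `r²` of the dilation. -/
theorem discInt_upper_bound {u : Plane → ℝ} (hu : Continuous u)
    (hexp : Integrable fun y => Real.exp (2 * u y)) {r : ℝ} (hr : 0 < r) :
    2 * discInt u r + 2 * (∫ y, discWeight y) * Real.log r + ∫ y, discWeight y ≤
      12 * ∫ y, Real.exp (2 * u y) := by
  refine le_trans ?_ (integral_discWeight_mul_exp_le hu hexp hr)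
  have h1 : Integrable fun y => discWeight y * u (r • y) :=
    integrable_discWeight_mul (by fun_prop)
  have h2 : Integrable discWeight := by
    simpa using integrable_discWeight_mul (g := fun _ => 1) continuous_const
  rw [discInt, ← integral_const_mul (r ^ 2)]
  rw [show 2 * (∫ y, discWeight y * u (r • y)) + 2 * (∫ y, discWeight y) * Real.log r +
      ∫ y, discWeight y = ∫ y, (2 * (discWeight y * u (r • y)) +
        (2 * Real.log r + 1) * discWeight y) by
    rw [integral_add (h1.const_mul 2) (h2.const_mul _), integral_const_mul, integral_const_mul]
    ring]
  refine integral_mono ((h1.const_mul 2).add (h2.const_mul _))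
    ((integrable_discWeight_mul (by fun_prop)).const_mul _) fun y => ?_
  have h3 : r ^ 2 * Real.exp (2 * u (r • y)) = Real.exp (2 * u (r • y) + 2 * Real.log r) := by
    rw [Real.exp_add, two_mul (Real.log r), Real.exp_add, Real.exp_log hr]
    ring
  have h4 := Real.add_one_le_exp (2 * u (r • y) + 2 * Real.log r)
  have h5 := mul_le_mul_of_nonneg_left h4 (discWeight_nonneg y)
  rw [← h3] at h5
  simp only
  linarith

/-- Averages of `u` against a fixed profile are `o(r)`. -/
theorem tendsto_inv_mul_integral_profile {u : Plane → ℝ} (hu : ContDiff ℝ ∞ u)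
    (hΔ : Integrable (Δ u)) (hexp : Integrable fun y => Real.exp (2 * u y)) {φ : Plane → ℝ}
    (hφ : Continuous φ) (hφ0 : ∀ y, 2 ≤ ‖y‖ ^ 2 → φ y = 0) :
    Filter.Tendsto (fun r : ℝ => r⁻¹ * ∫ y, φ y * u (r • y)) Filter.atTop (nhds 0) := by
  obtain ⟨C, hC⟩ := (isCompact_closedBall (0 : Plane) 2).exists_bound_of_continuousOn
    hφ.continuousOn
  have hC0 : 0 ≤ C := (norm_nonneg _).trans (hC 0 (by simp))
  -- The weight is at least `4` wherever `φ` can be nonzero, so a multiple of it dominates `φ`.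
  have hbd : ∀ y, |φ y| ≤ C * discWeight y := fun y => by
    by_cases hy : 2 ≤ ‖y‖ ^ 2
    · rw [hφ0 y hy, abs_zero]; exact mul_nonneg hC0 (discWeight_nonneg y)
    · push Not at hy
      have h1 := hC y (by
        simp only [Metric.mem_closedBall, dist_zero_right]; nlinarith [norm_nonneg y])
      have h2 := four_le_discWeight hy.le
      rw [Real.norm_eq_abs] at h1
      nlinarith
  have hcu := hu.continuous
  have hmain : ∀ r : ℝ, 1 ≤ r → |r⁻¹ * ∫ y, φ y * u (r • y)| ≤
      C * (12 * (∫ y, Real.exp (2 * u y)) - discInt u 1) * r⁻¹ +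
        C * (9 * ∫ y, |Δ u y|) * (Real.log r / r) := by
    intro r hr
    have hr0 : 0 < r := one_pos.trans_le hr
    -- Pointwise `|u| ≤ e^{2u} - u`: the exponential is controlled by the volume, and `-u` by the
    -- lower bound on the averages.
    have h1 : |∫ y, φ y * u (r • y)| ≤
        ∫ y, C * (discWeight y * Real.exp (2 * u (r • y)) - discWeight y * u (r • y)) := by
      rw [← Real.norm_eq_abs]
      refine norm_integral_le_of_norm_le (((integrable_discWeight_mul (by fun_prop)).sub
        (integrable_discWeight_mul (by fun_prop))).const_mul C) (.of_forall fun y => ?_)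
      rw [norm_mul, Real.norm_eq_abs, Real.norm_eq_abs, ← mul_sub, ← mul_assoc]
      refine mul_le_mul (hbd y) ?_ (abs_nonneg _) (mul_nonneg hC0 (discWeight_nonneg y))
      have := Real.add_one_le_exp (2 * u (r • y))
      have := Real.exp_pos (2 * u (r • y))
      rw [abs_le]; constructor <;> linarith
    rw [integral_const_mul, integral_sub (integrable_discWeight_mul (by fun_prop))
      (integrable_discWeight_mul (by fun_prop))] at h1
    have h2 := integral_discWeight_mul_exp_le hcu hexp hr0
    have h3 := discInt_lower_bound hu hΔ hr
    have h4 : 0 ≤ ∫ y : Plane, discWeight y * Real.exp (2 * u (r • y)) :=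
      integral_nonneg fun y => mul_nonneg (discWeight_nonneg y) (Real.exp_pos _).le
    have h5 : ∫ y : Plane, discWeight y * Real.exp (2 * u (r • y)) ≤
        12 * ∫ y, Real.exp (2 * u y) :=
      (le_mul_of_one_le_left h4 (one_le_pow₀ hr)).trans h2
    rw [show discInt u r = ∫ y, discWeight y * u (r • y) from rfl] at h3
    rw [abs_mul, abs_of_pos (inv_pos.2 hr0)]
    have h6 : |∫ y, φ y * u (r • y)| ≤ C * (12 * (∫ y, Real.exp (2 * u y)) - discInt u 1) +
        C * (9 * ∫ y, |Δ u y|) * Real.log r := by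
      refine h1.trans ?_
      rw [mul_assoc C, ← mul_add]
      exact mul_le_mul_of_nonneg_left (by linarith) hC0
    calc r⁻¹ * |∫ y, φ y * u (r • y)| ≤ r⁻¹ * _ :=
          mul_le_mul_of_nonneg_left h6 (inv_pos.2 hr0).le
      _ = _ := by ring
  have hlim : Filter.Tendsto (fun r : ℝ =>
      C * (12 * (∫ y, Real.exp (2 * u y)) - discInt u 1) * r⁻¹ +
        C * (9 * ∫ y, |Δ u y|) * (Real.log r / r)) Filter.atTop (nhds 0) := by
    have h1 := tendsto_inv_atTop_zero (𝕜 := ℝ)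
    have h2 : Filter.Tendsto (fun r : ℝ => Real.log r / r) Filter.atTop (nhds 0) :=
      Real.isLittleO_log_id_atTop.tendsto_div_nhds_zero
    simpa using (h1.const_mul _).add (h2.const_mul _)
  refine squeeze_zero_norm' ?_ hlim
  filter_upwards [Filter.eventually_ge_atTop 1] with r hr using hmain r hr

/-- A solution of finite volume has positive total curvature. -/
theorem integral_neg_laplacian_pos {u : Plane → ℝ} (hu : ContDiff ℝ ∞ u)
    (hΔ : Integrable (Δ u)) (hexp : Integrable fun y => Real.exp (2 * u y)) :
    ∫ y, Δ u y < 0 := by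
  by_contra! hcon
  set M := ∫ y, discWeight y with hM
  have hMpos : 0 < M := integral_discWeight_pos
  have hlim : Filter.Tendsto (fun r : ℝ => ∫ y : Plane, cutoffSq (‖r⁻¹ • y‖ ^ 2) * Δ u y)
      Filter.atTop (nhds (∫ y : Plane, 9 * Δ u y)) := by
    refine tendsto_integral_filter_of_dominated_convergence (fun y => 9 * |Δ u y|)
      (.of_forall fun r => ?_) (.of_forall fun r => .of_forall fun y => ?_) (hΔ.abs.const_mul 9)
      (.of_forall fun y => ?_)
    · exact ((contDiff_cutoffSq.continuous.comp (by fun_prop)).mul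
        hu.laplacian_plane.continuous).aestronglyMeasurable
    · rw [norm_mul, Real.norm_eq_abs, Real.norm_eq_abs, abs_of_nonneg (cutoffSq_nonneg _)]
      exact mul_le_mul_of_nonneg_right (cutoffSq_le (by positivity)) (abs_nonneg _)
    · refine Filter.Tendsto.mul_const _ ?_
      have : Continuous fun t : ℝ => cutoffSq (‖t • y‖ ^ 2) :=
        contDiff_cutoffSq.continuous.comp (by fun_prop)
      refine (this.tendsto' 0 9 ?_).comp tendsto_inv_atTop_zero
      norm_num [cutoffSq]
  rw [integral_const_mul] at hlim
  -- The cut-off integrals tend to `9 ∫ Δu ≥ 0`. With slack `M/2`, twice the average falls no faster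
  -- than `-M log r`, whereas finite volume requires decay like `-2M log r`.
  have hev : ∀ᶠ r : ℝ in Filter.atTop,
      -(M / 2) ≤ ∫ y : Plane, cutoffSq (‖r⁻¹ • y‖ ^ 2) * Δ u y :=
    hlim.eventually (le_mem_nhds (by linarith))
  obtain ⟨a, ha⟩ := Filter.eventually_atTop.1 hev
  set b := max a 1
  have hb : 0 < b := one_pos.trans_le (le_max_right _ _)
  have hlow : ∀ r, b ≤ r → discInt u b - M / 2 * (Real.log r - Real.log b) ≤ discInt u r :=
    fun r hr => sub_mul_log_le hb (fun r hr => hasDerivAt_discInt hu (hb.trans_le hr))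
      (fun r hr => by
        rw [mul_deriv_discInt u (hb.trans_le hr)]
        exact ha r ((le_max_left _ _).trans hr)) hr
  have hup := fun r hr => discInt_upper_bound hu.continuous hexp (r := r) hr
  have htop : Filter.Tendsto (fun r => M * Real.log r) Filter.atTop Filter.atTop :=
    Real.tendsto_log_atTop.const_mul_atTop hMpos
  obtain ⟨r, hr1, hr2⟩ := ((Filter.eventually_ge_atTop b).and (htop.eventually_gt_atTop
    (12 * (∫ y, Real.exp (2 * u y)) - M - 2 * discInt u b - M * Real.log b))).exists
  have h1 := hlow r hr1
  have h2 := hup r (hb.trans_le hr1)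
  linarith

/-! ### Representation of the gradient by the logarithmic kernel -/

/-- A smooth transition from `0` on `(-∞, 1/2]` to `1` on `[1, ∞)`. -/
noncomputable def trunc (s : ℝ) : ℝ := Real.smoothTransition (2 * s - 1)

theorem contDiff_trunc {n : ℕ∞} : ContDiff ℝ n trunc :=
  Real.smoothTransition.contDiff.comp ((contDiff_const.mul contDiff_id).sub contDiff_const)

theorem continuous_trunc : Continuous trunc := (contDiff_trunc (n := 0)).continuous

theorem trunc_of_le {s : ℝ} (hs : s ≤ 1 / 2) : trunc s = 0 :=
  Real.smoothTransition.zero_of_nonpos (by linarith)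

theorem trunc_of_ge (s : ℝ) (hs : 1 ≤ s) : trunc s = 1 :=
  Real.smoothTransition.one_of_one_le (by linarith)

theorem trunc_nonneg (s : ℝ) : 0 ≤ trunc s := Real.smoothTransition.nonneg _

theorem trunc_le_one (s : ℝ) : trunc s ≤ 1 := Real.smoothTransition.le_one _

theorem trunc_zero : trunc 0 = 0 := trunc_of_le (by norm_num)

theorem contDiff_deriv_trunc : ContDiff ℝ 1 (deriv trunc) :=
  ContDiff.deriv' (n := 1) (by simpa [one_add_one_eq_two] using contDiff_trunc (n := 2))

theorem deriv_trunc_of_ge (s : ℝ) (hs : 3 / 2 ≤ s) : deriv trunc s = 0 :=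
  deriv_eq_zero_of_eq_const trunc_of_ge (by norm_num) s hs

theorem contDiff_trunc_div (a : ℝ) : ContDiff ℝ 1 (fun s => trunc (a * s) / s) := by
  have hT : ContDiff ℝ 1 (fun s => trunc (a * s)) :=
    (contDiff_trunc (n := 1)).comp (contDiff_const.mul contDiff_id)
  rw [contDiff_iff_contDiffAt]
  intro s
  rcases eq_or_ne s 0 with rfl | hs
  · have h1 : (fun s => trunc (a * s) / s) =ᶠ[nhds 0] fun _ => 0 := by
      have h2 : Filter.Tendsto (fun s : ℝ => a * s) (nhds 0) (nhds 0) :=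
        Continuous.tendsto' (by fun_prop) _ _ (by simp)
      filter_upwards [h2.eventually (gt_mem_nhds (show (0 : ℝ) < 1 / 2 by norm_num))] with t ht
      rw [trunc_of_le ht.le, zero_div]
    exact contDiffAt_const.congr_of_eventuallyEq h1
  · exact hT.contDiffAt.div contDiffAt_id hs

/-- The gradient kernel `y / ‖y‖ ^ 2` of the logarithmic potential, truncated at scale `r`. -/
noncomputable def kern (r : ℝ) (i : Fin 2) (y : Plane) : ℝ :=
  trunc ((r⁻¹) ^ 2 * ‖y‖ ^ 2) / ‖y‖ ^ 2 * y i

theorem continuous_kern (r : ℝ) (i : Fin 2) : Continuous (kern r i) :=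
  (contDiff_radial (contDiff_trunc_div ((r⁻¹) ^ 2))).continuous.mul
    (contDiff_coord (n := 0) i).continuous

theorem abs_coord_le_norm (y : Plane) (i : Fin 2) : |y i| ≤ ‖y‖ := by
  simpa using PiLp.norm_apply_le y i

theorem abs_kern_le {r : ℝ} (hr : 0 < r) (i : Fin 2) (y : Plane) : |kern r i y| ≤ 2 * r⁻¹ := by
  unfold kern
  by_cases h : (r⁻¹) ^ 2 * ‖y‖ ^ 2 ≤ 1 / 2
  · rw [trunc_of_le h]; simp [hr.le]
  · have hr' := inv_pos.2 hr
    have hy : 0 < ‖y‖ := by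
      rcases (norm_nonneg y).eq_or_lt with h0 | h0
      · rw [← h0] at h; norm_num at h
      · exact h0
    rw [abs_mul, abs_div, abs_of_nonneg (trunc_nonneg _), abs_of_pos (by positivity : 0 < ‖y‖ ^ 2),
      div_mul_eq_mul_div, div_le_iff₀ (by positivity)]
    have h1 : trunc ((r⁻¹) ^ 2 * ‖y‖ ^ 2) * |y i| ≤ 1 * ‖y‖ :=
      mul_le_mul (trunc_le_one _) (abs_coord_le_norm y i) (abs_nonneg _) zero_le_one
    -- Where the truncation is nonzero, `‖y‖/r > 1/√2`, which is more than `1/2`.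
    have h2 : 1 ≤ 2 * r⁻¹ * ‖y‖ := by
      have : 0 < r⁻¹ * ‖y‖ := by positivity
      nlinarith
    nlinarith

theorem integrable_kern_mul {r : ℝ} (hr : 0 < r) (i : Fin 2) {g : Plane → ℝ}
    (hg : Integrable g) : Integrable fun y => kern r i y * g y :=
  hg.bdd_mul (continuous_kern r i).aestronglyMeasurable (.of_forall fun y => abs_kern_le hr i y)

theorem trunc_mul_ge {a s : ℝ} (ha : 0 < a) (hs : a⁻¹ ≤ s) : trunc (a * s) = 1 :=
  trunc_of_ge _ (by rwa [inv_le_iff_one_le_mul₀' ha] at hs)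

/-- The left side is the divergence of the truncated kernel at `s = ‖y‖²`. In two dimensions
`y/‖y‖²` is divergence-free off the origin, so only the derivative of the truncation survives. The
proof differentiates `s * (trunc (a * s) / s) = trunc (a * s)`. -/
theorem deriv_trunc_div (a s : ℝ) :
    2 * (trunc (a * s) / s) + 2 * s * deriv (fun s => trunc (a * s) / s) s =
      2 * a * deriv trunc (a * s) := by
  have h1 : (fun s => s * (trunc (a * s) / s)) = fun s => trunc (a * s) := by
    funext t
    rcases eq_or_ne t 0 with rfl | ht
    · simp [trunc_zero]
    · field_simp
  have h2 : HasDerivAt (fun s => s * (trunc (a * s) / s)) _ s := (hasDerivAt_id' s).mul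
    ((contDiff_trunc_div a).differentiable one_ne_zero s).hasDerivAt
  have h3 : HasDerivAt (fun s => trunc (a * s)) (deriv trunc (a * s) * a) s := by
    have := ((contDiff_trunc (n := 1)).differentiable one_ne_zero (a * s)).hasDerivAt.comp s
      ((hasDerivAt_id' s).const_mul a)
    exact HasDerivAt.congr_deriv (f := fun s => trunc (a * s)) this (by simp)
  rw [h1] at h2
  have := h2.unique h3
  linarith

/-- The radial mollifier `2 * deriv trunc (‖y‖ ^ 2)`. -/
noncomputable def mollifier (y : Plane) : ℝ := 2 * deriv trunc (‖y‖ ^ 2)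

theorem continuous_mollifier : Continuous mollifier :=
  continuous_const.mul (contDiff_deriv_trunc.continuous.comp (by fun_prop))

theorem hasCompactSupport_mollifier : HasCompactSupport mollifier :=
  (hasCompactSupport_radial deriv_trunc_of_ge).mul_left

theorem integral_mollifier_smul {w : Plane → ℝ} {r : ℝ} (hr : 0 < r) :
    ∫ y, 2 * (r⁻¹) ^ 2 * deriv trunc ((r⁻¹) ^ 2 * ‖y‖ ^ 2) * w y =
      ∫ y, mollifier y * w (r • y) := by
  rw [← integral_comp_smul_plane _ hr, ← integral_const_mul]
  refine integral_congr_ae (.of_forall fun y => ?_)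
  simp only [mollifier, norm_smul, mul_pow, Real.norm_eq_abs, sq_abs]
  have h1 : (r⁻¹) ^ 2 * (r ^ 2 * ‖y‖ ^ 2) = ‖y‖ ^ 2 := by field_simp
  rw [h1]
  field_simp

/-- Both truncations equal `1` far out, so the difference of the kernels is a compactly supported
curl-free radial field, and integration by parts applies without any decay of `u`. Its divergence is
the difference of the mollifiers at the two scales. -/
theorem integral_kern_mul_laplacian_two_scale {u : Plane → ℝ} (hu : ContDiff ℝ ∞ u)
    (hΔ : Integrable (Δ u)) {r R : ℝ} (hr : 0 < r) (hR : 0 < R) (i : Fin 2) :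
    (∫ y, kern r i y * Δ u y) + ∫ y, mollifier y * pd i u (r • y) =
      (∫ y, kern R i y * Δ u y) + ∫ y, mollifier y * pd i u (R • y) := by
  set a := (r⁻¹) ^ 2 with ha
  set b := (R⁻¹) ^ 2 with hb
  have ha0 : 0 < a := by positivity
  have hb0 : 0 < b := by positivity
  set q : ℝ → ℝ := fun s => trunc (a * s) / s - trunc (b * s) / s with hq
  have hq1 : ContDiff ℝ 1 q := (contDiff_trunc_div a).sub (contDiff_trunc_div b)
  have hqS : ∀ s, a⁻¹ + b⁻¹ ≤ s → q s = 0 := fun s hs => by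
    have := inv_pos.2 ha0
    have := inv_pos.2 hb0
    simp only [hq]
    rw [trunc_mul_ge ha0 (by linarith), trunc_mul_ge hb0 (by linarith), sub_self]
  have hqd : ∀ s, 2 * q s + 2 * s * deriv q s =
      2 * a * deriv trunc (a * s) - 2 * b * deriv trunc (b * s) := fun s => by
    rw [← deriv_trunc_div a s, ← deriv_trunc_div b s]
    simp only [hq]
    rw [deriv_fun_sub ((contDiff_trunc_div a).differentiable one_ne_zero s)
      ((contDiff_trunc_div b).differentiable one_ne_zero s)]
    ring
  have key := integral_radial_mul_coord_mul_laplacian hq1 hqS hu i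
  simp_rw [hqd] at key
  have h1 : ∀ y : Plane, q (‖y‖ ^ 2) * y i * Δ u y = kern r i y * Δ u y - kern R i y * Δ u y :=
    fun y => by simp only [hq, kern]; ring
  have h2 : ∀ t : ℝ, 0 < t → Integrable fun y : Plane =>
      2 * (t⁻¹) ^ 2 * deriv trunc ((t⁻¹) ^ 2 * ‖y‖ ^ 2) * pd i u y := fun t ht => by
    have hc : HasCompactSupport fun y : Plane => deriv trunc ((t⁻¹) ^ 2 * ‖y‖ ^ 2) :=
      hasCompactSupport_radial (q := fun s => deriv trunc ((t⁻¹) ^ 2 * s))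
        (S := t ^ 2 * (3 / 2)) fun s hs => deriv_trunc_of_ge _ (by
          calc (3 / 2 : ℝ) = (t⁻¹) ^ 2 * (t ^ 2 * (3 / 2)) := by field_simp
            _ ≤ _ := mul_le_mul_of_nonneg_left hs (by positivity))
    exact ((continuous_const.mul (contDiff_deriv_trunc.continuous.comp (by fun_prop))).mul
      (hu.pd i).continuous).integrable_of_hasCompactSupport hc.mul_left.mul_right
  simp_rw [h1, sub_mul] at key
  rw [integral_sub (integrable_kern_mul hr i hΔ) (integrable_kern_mul hR i hΔ),
    integral_sub (h2 r hr) (h2 R hR), integral_mollifier_smul hr, integral_mollifier_smul hR] at key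
  linarith

/-- Moving the derivative onto the mollifier gains a factor `r⁻¹`, and averages of `u` are `o(r)`.
This is what excludes a harmonic remainder in the representation of `∇u`. -/
theorem tendsto_integral_mollifier_mul_pd {u : Plane → ℝ} (hu : ContDiff ℝ ∞ u)
    (hΔ : Integrable (Δ u)) (hexp : Integrable fun y => Real.exp (2 * u y)) (i : Fin 2) :
    Filter.Tendsto (fun r : ℝ => ∫ y, mollifier y * pd i u (r • y)) Filter.atTop (nhds 0) := by
  have h1 := tendsto_inv_mul_integral_profile hu hΔ hexp
    (φ := fun y => -(2 * deriv (fun s => 2 * deriv trunc s) (‖y‖ ^ 2) * y i)) ?_ ?_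
  · refine h1.congr' ?_
    filter_upwards [Filter.eventually_gt_atTop 0] with r hr
    have h2 := integral_radial_mul_pd (p := fun s => 2 * deriv trunc s) (S := 3 / 2)
      (contDiff_const.mul contDiff_deriv_trunc) (fun s hs => by simp [deriv_trunc_of_ge s hs])
      ((contDiff_comp_affine hu 0 r).of_le (by simp)) i
    unfold pd at h2
    simp_rw [fderiv_comp_affine (hu.differentiable (by simp)), zero_add] at h2
    rw [inv_mul_eq_iff_eq_mul₀ hr.ne', ← integral_const_mul]
    simp_rw [neg_mul]
    rw [integral_neg, ← h2]
    refine integral_congr_ae (.of_forall fun y => ?_)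
    simp only [mollifier, pd]
    ring
  · have : Continuous (deriv (fun s => 2 * deriv trunc s)) :=
      (contDiff_const.mul contDiff_deriv_trunc).continuous_deriv le_rfl
    exact ((continuous_const.mul (this.comp (by fun_prop))).mul
      (contDiff_coord (n := 0) i).continuous).neg
  · intro y hy
    rw [deriv_eq_zero_of_eq_const (S := 3 / 2) (c := 0)
      (fun s hs => by simp [deriv_trunc_of_ge s hs]) (by norm_num : (3 / 2 : ℝ) < 2) _ hy]
    simp

/-- Representation of the mollified gradient by the truncated logarithmic gradient kernel. -/
theorem integral_kern_mul_laplacian {u : Plane → ℝ} (hu : ContDiff ℝ ∞ u)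
    (hΔ : Integrable (Δ u)) (hexp : Integrable fun y => Real.exp (2 * u y)) {r : ℝ} (hr : 0 < r)
    (i : Fin 2) :
    ∫ y, kern r i y * Δ u y = -∫ y, mollifier y * pd i u (r • y) := by
  have h1 : Filter.Tendsto (fun R : ℝ => ∫ y, kern R i y * Δ u y) Filter.atTop (nhds 0) := by
    have hlim : Filter.Tendsto (fun R : ℝ => 2 * R⁻¹ * ∫ y, |Δ u y|) Filter.atTop (nhds 0) := by
      simpa using (tendsto_inv_atTop_zero.const_mul 2).mul_const (∫ y, |Δ u y|)
    refine squeeze_zero_norm' ?_ hlim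
    filter_upwards [Filter.eventually_gt_atTop 0] with R hR
    rw [← integral_const_mul]
    refine norm_integral_le_of_norm_le (hΔ.abs.const_mul _) (.of_forall fun y => ?_)
    rw [norm_mul]
    exact mul_le_mul_of_nonneg_right (abs_kern_le hR i y) (norm_nonneg _)
  have h2 := h1.add (tendsto_integral_mollifier_mul_pd hu hΔ hexp i)
  have h3 : (∫ y, kern r i y * Δ u y) + ∫ y, mollifier y * pd i u (r • y) = 0 + 0 := by
    refine tendsto_nhds_unique (tendsto_const_nhds.congr' ?_) h2
    filter_upwards [Filter.eventually_gt_atTop 0] with R hR using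
      integral_kern_mul_laplacian_two_scale hu hΔ hr hR i
  linarith

theorem integral_kern_mul_laplacian_translate {u : Plane → ℝ} (hu : ContDiff ℝ ∞ u)
    (hΔ : Integrable (Δ u)) (hexp : Integrable fun y => Real.exp (2 * u y)) {r : ℝ} (hr : 0 < r)
    (i : Fin 2) (x : Plane) :
    ∫ z, kern r i (z - x) * Δ u z = -∫ y, mollifier y * pd i u (x + r • y) := by
  have hw : ContDiff ℝ ∞ fun y => u (x + (1 : ℝ) • y) := contDiff_comp_affine hu x 1
  have hΔw : Δ (fun y => u (x + (1 : ℝ) • y)) = fun y => Δ u (x + y) := funext fun y => by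
    rw [laplacian_comp_affine hu]; simp
  have hpw : pd i (fun y => u (x + (1 : ℝ) • y)) = fun y => pd i u (x + y) := funext fun y => by
    unfold pd
    rw [fderiv_comp_affine (hu.differentiable (by simp))]; simp
  have := integral_kern_mul_laplacian hw (by rw [hΔw]; exact hΔ.comp_add_left x)
    (by simpa using hexp.comp_add_left x) hr i
  rw [hΔw, hpw] at this
  rw [← this, ← integral_add_left_eq_self _ x]
  simp

/-- In polar coordinates the radial integrand is the derivative of `trunc (t ^ 2)`, whose total
increase is `1`; the factor `2π` is twice the area of the unit disc. -/
theorem integral_mollifier : ∫ y, mollifier y = 2 * Real.pi := by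
  have h1 := integral_fun_norm_addHaar (volume : Measure Plane) (fun t => 2 * deriv trunc (t ^ 2))
  have h2 : volume.real (Metric.ball (0 : Plane) 1) = Real.pi := by
    rw [Measure.real, EuclideanSpace.volume_ball_fin_two]
    simp [Real.pi_pos.le]
  have hd : ∀ t : ℝ, HasDerivAt (fun t => trunc (t ^ 2)) (t * (2 * deriv trunc (t ^ 2))) t := by
    intro t
    have := ((contDiff_trunc (n := 1)).differentiable one_ne_zero (t ^ 2)).hasDerivAt.comp t
      (hasDerivAt_pow 2 t)
    refine this.congr_deriv ?_
    norm_num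
    ring
  have h3 : ∫ t in Set.Ioi (0 : ℝ), t * (2 * deriv trunc (t ^ 2)) = 1 - trunc (0 ^ 2) := by
    refine integral_Ioi_of_hasDerivAt_of_tendsto' (fun t _ => hd t) ?_ ?_
    · have hc : HasCompactSupport fun t : ℝ => t * (2 * deriv trunc (t ^ 2)) := by
        refine HasCompactSupport.intro (isCompact_closedBall (0 : ℝ) 2) fun t ht => ?_
        simp only [Metric.mem_closedBall, dist_zero_right, Real.norm_eq_abs, not_le] at ht
        rw [deriv_trunc_of_ge _ (by rw [← sq_abs]; nlinarith)]
        simp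
      exact ((continuous_id.mul (continuous_const.mul (contDiff_deriv_trunc.continuous.comp
        (by fun_prop)))).integrable_of_hasCompactSupport hc).integrableOn
    · refine tendsto_const_nhds.congr' ?_
      filter_upwards [Filter.eventually_ge_atTop 1] with t ht
      rw [trunc_of_ge _ (by nlinarith)]
  simp only [finrank_euclideanSpace, Fintype.card_fin, h2, smul_eq_mul, Nat.add_one_sub_one,
    pow_one, nsmul_eq_mul] at h1
  rw [h3] at h1
  simpa [mollifier, trunc_zero] using h1

/-! ### Symmetrization with the cut-off identity field -/

/-- The identity vector field cut off at scale `R`. -/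
noncomputable def cutField (R : ℝ) (x : Plane) : Plane := (1 - trunc ((R⁻¹) ^ 2 * ‖x‖ ^ 2)) • x

theorem cutField_apply (R : ℝ) (x : Plane) (i : Fin 2) :
    cutField R x i = (1 - trunc ((R⁻¹) ^ 2 * ‖x‖ ^ 2)) * x i := by
  simp [cutField]

theorem contDiff_one_sub_trunc (a : ℝ) : ContDiff ℝ 1 fun s => 1 - trunc (a * s) :=
  contDiff_const.sub ((contDiff_trunc (n := 1)).comp (contDiff_const.mul contDiff_id))

theorem contDiff_cutField (R : ℝ) : ContDiff ℝ 1 (cutField R) :=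
  (contDiff_radial (contDiff_one_sub_trunc ((R⁻¹) ^ 2))).smul contDiff_id

theorem continuous_cutField_apply (R : ℝ) (i : Fin 2) : Continuous fun x => cutField R x i :=
  (contDiff_coord (n := 0) i).continuous.comp (contDiff_cutField R).continuous

theorem hasCompactSupport_cutoff {R : ℝ} (hR : 0 < R) :
    HasCompactSupport fun x : Plane => 1 - trunc ((R⁻¹) ^ 2 * ‖x‖ ^ 2) :=
  hasCompactSupport_radial (q := fun s => 1 - trunc ((R⁻¹) ^ 2 * s)) fun s hs => by
    rw [trunc_mul_ge (by positivity) hs, sub_self]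

theorem hasCompactSupport_cutField {R : ℝ} (hR : 0 < R) : HasCompactSupport (cutField R) :=
  (hasCompactSupport_cutoff hR).smul_right

/-- The cut-off identity fields are Lipschitz uniformly in the scale. -/
theorem exists_lipschitz_cutField :
    ∃ C : ℝ, 0 ≤ C ∧ ∀ R : ℝ, 0 < R → ∀ x z, ‖cutField R x - cutField R z‖ ≤ C * ‖x - z‖ := by
  obtain ⟨C, hC⟩ := ContDiff.lipschitzWith_of_hasCompactSupport
    (hasCompactSupport_cutField one_pos) (contDiff_cutField 1) one_ne_zero
  refine ⟨C, C.2, fun R hR x z => ?_⟩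
  -- The fields at different scales are conjugate by dilation, so the Lipschitz constant at scale
  -- `1` serves for every `R`.
  have h1 : ∀ x, cutField R x = R • cutField 1 (R⁻¹ • x) := fun x => by
    simp only [cutField, norm_smul, mul_pow, Real.norm_eq_abs, sq_abs, inv_one, one_pow, one_mul]
    rw [smul_comm, smul_smul R, mul_inv_cancel₀ hR.ne', one_smul]
  rw [h1, h1, ← smul_sub, norm_smul, Real.norm_eq_abs, abs_of_pos hR]
  have h2 := hC.dist_le_mul (R⁻¹ • x) (R⁻¹ • z)
  rw [dist_eq_norm, dist_eq_norm, ← smul_sub, norm_smul, Real.norm_eq_abs,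
    abs_of_pos (inv_pos.2 hR)] at h2
  calc R * ‖cutField 1 (R⁻¹ • x) - cutField 1 (R⁻¹ • z)‖ ≤ R * (C * (R⁻¹ * ‖x - z‖)) :=
        mul_le_mul_of_nonneg_left h2 hR.le
    _ = C * ‖x - z‖ := by field_simp

/-- The symmetrized kernel `⟪V x - V z, x - z⟫ / ‖x - z‖ ^ 2` of the cut-off field `V`. -/
noncomputable def symKernel (R : ℝ) (q : Plane × Plane) : ℝ :=
  inner ℝ (q.1 - q.2) (cutField R q.1 - cutField R q.2) / ‖q.1 - q.2‖ ^ 2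

/-- The Lipschitz bound cancels the singularity on the diagonal. With `C` independent of `R`, this
gives the dominating function for both limits, first `r → 0` and then `R → ∞`. -/
theorem abs_symKernel_le {C R : ℝ} (hC0 : 0 ≤ C)
    (hC : ∀ x z, ‖cutField R x - cutField R z‖ ≤ C * ‖x - z‖) (q : Plane × Plane) :
    |symKernel R q| ≤ C := by
  rw [symKernel, abs_div, abs_of_nonneg (sq_nonneg ‖q.1 - q.2‖)]
  refine div_le_of_le_mul₀ (sq_nonneg _) hC0 ((abs_real_inner_le_norm _ _).trans ?_)
  nlinarith [hC q.1 q.2, norm_nonneg (q.1 - q.2)]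

theorem measurable_symKernel (R : ℝ) : Measurable (symKernel R) := by
  have h := (contDiff_cutField R).continuous
  have h1 : Continuous fun q : Plane × Plane =>
      inner ℝ (q.1 - q.2) (cutField R q.1 - cutField R q.2) := by fun_prop
  have h2 : Continuous fun q : Plane × Plane => ‖q.1 - q.2‖ ^ 2 := by fun_prop
  exact h1.measurable.div h2.measurable

theorem sum_kern_eq_trunc_mul_symKernel (r R : ℝ) (x z : Plane) :
    ∑ i, (cutField R x i - cutField R z i) * kern r i (x - z) =
      trunc ((r⁻¹) ^ 2 * ‖x - z‖ ^ 2) * symKernel R (x, z) := by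
  simp only [symKernel, kern, PiLp.inner_apply, RCLike.inner_apply, conj_trivial,
    PiLp.sub_apply, Fin.sum_univ_two]
  ring

theorem kern_neg (r : ℝ) (i : Fin 2) (y : Plane) : kern r i (-y) = -kern r i y := by
  simp [kern]

theorem integrable_bdd_mul_prod {D : Plane → ℝ} (hD : Integrable D) {Q : Plane × Plane → ℝ}
    (hQ : Measurable Q) {C : ℝ} (hC : ∀ q, |Q q| ≤ C) :
    Integrable (fun q : Plane × Plane => Q q * (D q.1 * D q.2)) (volume.prod volume) :=
  (hD.mul_prod hD).bdd_mul hQ.aestronglyMeasurable (.of_forall hC)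

theorem measurable_trunc_mul_symKernel (r R : ℝ) : Measurable fun q : Plane × Plane =>
    trunc ((r⁻¹) ^ 2 * ‖q.1 - q.2‖ ^ 2) * symKernel R q := by
  refine Measurable.mul (Continuous.measurable ?_) (measurable_symKernel R)
  exact continuous_trunc.comp (by fun_prop)

/-- Symmetrization of the double integral of the logarithmic gradient kernel. -/
theorem sum_integral_cutField_mul_kern {D : Plane → ℝ} (hD : Integrable D) {r R : ℝ} (hr : 0 < r)
    (hR : 0 < R) :
    ∑ i, ∫ x, cutField R x i * D x * ∫ z, kern r i (z - x) * D z =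
      -(1 / 2) * ∫ q : Plane × Plane, trunc ((r⁻¹) ^ 2 * ‖q.1 - q.2‖ ^ 2) * symKernel R q *
        (D q.1 * D q.2) ∂(volume.prod volume) := by
  have hVc := continuous_cutField_apply R
  obtain ⟨B, hB⟩ := (hasCompactSupport_cutField hR).exists_bound_of_continuous
    (contDiff_cutField R).continuous
  have hVb : ∀ i x, |cutField R x i| ≤ B := fun i x => (abs_coord_le_norm _ _).trans (hB x)
  have hkc : ∀ i, Continuous fun q : Plane × Plane => kern r i (q.2 - q.1) := fun i =>
    (continuous_kern r i).comp (by fun_prop)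
  have hI1 : ∀ i, Integrable (fun q : Plane × Plane =>
      (cutField R q.1 i * kern r i (q.2 - q.1)) * (D q.1 * D q.2)) (volume.prod volume) :=
    fun i => integrable_bdd_mul_prod hD
      (((hVc i).comp continuous_fst).mul (hkc i)).measurable (C := B * (2 * r⁻¹)) fun q => by
        rw [abs_mul]
        exact mul_le_mul (hVb i _) (abs_kern_le hr i _) (abs_nonneg _)
          ((norm_nonneg _).trans (hB 0))
  have hstep : ∀ i, ∫ x, cutField R x i * D x * ∫ z, kern r i (z - x) * D z =
      ∫ q : Plane × Plane, (cutField R q.1 i * kern r i (q.2 - q.1)) * (D q.1 * D q.2)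
        ∂(volume.prod volume) := fun i => by
    rw [integral_prod _ (hI1 i)]
    refine integral_congr_ae (.of_forall fun x => ?_)
    simp only
    rw [← integral_const_mul]
    refine integral_congr_ae (.of_forall fun z => ?_)
    simp only
    ring
  simp_rw [hstep]
  rw [← integral_finsetSum _ fun i _ => hI1 i]
  set G : Plane × Plane → ℝ := fun q =>
    ∑ i, (cutField R q.1 i * kern r i (q.2 - q.1)) * (D q.1 * D q.2) with hG
  have hGi : Integrable G (volume.prod volume) := integrable_finsetSum _ fun i _ => hI1 i
  have hsw : ∫ q, G q ∂(volume.prod volume) =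
      ∫ q : Plane × Plane, G q.swap ∂(volume.prod volume) :=
    (integral_prod_swap (μ := volume) (ν := volume) G).symm
  -- The integrand is averaged with its image under exchange of the variables; as the kernel is odd,
  -- the field enters only through `V x - V z`.
  have hsum : ∫ q, G q ∂(volume.prod volume) =
      (1 / 2) * ∫ q : Plane × Plane, (G q + G q.swap) ∂(volume.prod volume) := by
    have h := integral_add hGi hGi.swap
    simp only [Function.comp_apply] at h
    rw [h, ← hsw]
    ring
  rw [hsum, ← integral_const_mul, ← integral_const_mul]
  refine integral_congr_ae (.of_forall fun q => ?_)
  simp only [hG]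
  rw [← sum_kern_eq_trunc_mul_symKernel r R q.1 q.2]
  simp only [Prod.fst_swap, Prod.snd_swap, Fin.sum_univ_two]
  simp only [← neg_sub q.1 q.2, kern_neg]
  ring

theorem tendsto_integral_trunc_symKernel {D : Plane → ℝ} (hD : Integrable D) {R : ℝ}
    (hR : 0 < R) :
    Filter.Tendsto (fun r : ℝ => ∫ q : Plane × Plane, trunc ((r⁻¹) ^ 2 * ‖q.1 - q.2‖ ^ 2) *
      symKernel R q * (D q.1 * D q.2) ∂(volume.prod volume)) (nhdsWithin 0 (Set.Ioi 0))
      (nhds (∫ q : Plane × Plane, symKernel R q * (D q.1 * D q.2) ∂(volume.prod volume))) := by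
  obtain ⟨C, hC0, hC⟩ := exists_lipschitz_cutField
  have hDD := hD.mul_prod hD
  refine tendsto_integral_filter_of_dominated_convergence
    (fun q : Plane × Plane => C * |D q.1 * D q.2|) (.of_forall fun r => ?_)
    (.of_forall fun r => .of_forall fun q => ?_) (hDD.abs.const_mul C) (.of_forall fun q => ?_)
  · exact (measurable_trunc_mul_symKernel r R).aestronglyMeasurable.mul hDD.aestronglyMeasurable
  · rw [norm_mul, norm_mul, Real.norm_eq_abs, Real.norm_eq_abs, abs_of_nonneg (trunc_nonneg _)]
    refine mul_le_mul_of_nonneg_right ?_ (abs_nonneg _)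
    calc _ ≤ 1 * C := mul_le_mul (trunc_le_one _) (abs_symKernel_le hC0 (hC R hR) q)
          (abs_nonneg _) zero_le_one
      _ = C := one_mul C
  · refine Filter.Tendsto.mul_const _ ?_
    by_cases hq : q.1 = q.2
    · have : symKernel R q = 0 := by simp [symKernel, hq]
      simp [this]
    · have hpos : 0 < ‖q.1 - q.2‖ := norm_pos_iff.2 (sub_ne_zero.2 hq)
      refine tendsto_const_nhds.congr' ?_
      filter_upwards [Ioo_mem_nhdsGT hpos] with r hr
      have h0 := hr.1
      have h1 : 1 ≤ r⁻¹ * ‖q.1 - q.2‖ := by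
        rw [inv_mul_eq_div, one_le_div h0]; exact hr.2.le
      rw [← mul_pow, trunc_of_ge _ (one_le_pow₀ h1), one_mul]

theorem prod_diagonal_null :
    ∀ᵐ q : Plane × Plane ∂((volume : Measure Plane).prod volume), q.1 ≠ q.2 := by
  have hm : MeasurableSet {q : Plane × Plane | q.1 = q.2} := isClosed_diagonal.measurableSet
  rw [ae_iff]
  simp only [not_not]
  rw [Measure.measure_prod_null hm]
  refine .of_forall fun x => ?_
  have : Prod.mk x ⁻¹' {q : Plane × Plane | q.1 = q.2} = {x} := by
    ext z; simp [eq_comm]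
  simp [this]

/-- Once `R` is large compared with both points, the field is the identity at each of them and the
kernel equals `1` off the diagonal, a null set. -/
theorem tendsto_integral_symKernel {D : Plane → ℝ} (hD : Integrable D) :
    Filter.Tendsto (fun R : ℝ => ∫ q : Plane × Plane, symKernel R q * (D q.1 * D q.2)
      ∂(volume.prod volume)) Filter.atTop (nhds ((∫ x, D x) ^ 2)) := by
  obtain ⟨C, hC0, hC⟩ := exists_lipschitz_cutField
  have hDD := hD.mul_prod hD
  rw [sq, ← integral_prod_mul]
  refine tendsto_integral_filter_of_dominated_convergence
    (fun q : Plane × Plane => C * |D q.1 * D q.2|) (.of_forall fun r => ?_)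
    ?_ (hDD.abs.const_mul C) ?_
  · exact (measurable_symKernel r).aestronglyMeasurable.mul hDD.aestronglyMeasurable
  · filter_upwards [Filter.eventually_gt_atTop 0] with R hR
    refine .of_forall fun q => ?_
    rw [norm_mul]
    exact mul_le_mul_of_nonneg_right (abs_symKernel_le hC0 (hC R hR) q) (norm_nonneg _)
  · filter_upwards [prod_diagonal_null] with q hq
    have hpos : 0 < ‖q.1 - q.2‖ := norm_pos_iff.2 (sub_ne_zero.2 hq)
    refine tendsto_const_nhds.congr' ?_
    filter_upwards [Filter.eventually_ge_atTop (2 * ‖q.1‖ + 2 * ‖q.2‖ + 1)] with R hR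
    have hid : ∀ x : Plane, 2 * ‖x‖ ≤ R → 0 < R → cutField R x = x := fun x hx h0 => by
      have h1 : R⁻¹ * ‖x‖ ≤ 1 / 2 := by
        rw [inv_mul_eq_div, div_le_iff₀ h0]; linarith
      have h2 : 0 ≤ R⁻¹ * ‖x‖ := by positivity
      rw [cutField, ← mul_pow, trunc_of_le (by nlinarith), sub_zero, one_smul]
    have hn1 := norm_nonneg q.1
    have hn2 := norm_nonneg q.2
    rw [symKernel, hid _ (by linarith) (by linarith), hid _ (by linarith) (by linarith),
      real_inner_self_eq_norm_sq, div_self (by positivity), one_mul]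

theorem integral_cutField_mul_pd {u : Plane → ℝ} (hu : ContDiff ℝ ∞ u) (hΔ : Integrable (Δ u))
    (hexp : Integrable fun y => Real.exp (2 * u y)) {R : ℝ} (hR : 0 < R) :
    2 * Real.pi * ∑ i, ∫ x, cutField R x i * Δ u x * pd i u x =
      (1 / 2) * ∫ q : Plane × Plane, symKernel R q * (Δ u q.1 * Δ u q.2)
        ∂(volume.prod volume) := by
  have hVc := continuous_cutField_apply R
  have hDc := hu.laplacian_plane.continuous
  -- Continuity up to `r = 0`, where the mollified derivative equals `2π ∂ᵢu(x)`, identifies the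
  -- limit of the left side.
  have hG : ∀ i, Continuous fun p : ℝ × Plane =>
      ∫ y, mollifier y * pd i u (p.2 + p.1 • y) := fun i => by
    rw [← continuousOn_univ]
    refine continuousOn_integral_of_compact_support (k := tsupport mollifier)
      hasCompactSupport_mollifier (Continuous.continuousOn ?_) fun p y _ hy => ?_
    · exact (continuous_mollifier.comp continuous_snd).mul
        ((hu.pd i).continuous.comp (by fun_prop))
    · rw [image_eq_zero_of_notMem_tsupport hy, zero_mul]
  have hH : ∀ i, Continuous fun r : ℝ =>
      ∫ x, cutField R x i * Δ u x * ∫ y, mollifier y * pd i u (x + r • y) := fun i => by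
    rw [← continuousOn_univ]
    refine continuousOn_integral_of_compact_support (k := tsupport (cutField R))
      (hasCompactSupport_cutField hR) (Continuous.continuousOn ?_) fun p y _ hy => ?_
    · exact (((hVc i).comp continuous_snd).mul (hDc.comp continuous_snd)).mul (hG i)
    · rw [image_eq_zero_of_notMem_tsupport hy]; simp
  have hsum : Continuous fun r : ℝ =>
      ∑ i, ∫ x, cutField R x i * Δ u x * ∫ y, mollifier y * pd i u (x + r • y) :=
    continuous_finsetSum _ fun i _ => hH i
  have hlim := (hsum.tendsto 0).mono_left (nhdsWithin_le_nhds (s := Set.Ioi 0))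
  have hlim2 := (tendsto_integral_trunc_symKernel hΔ hR).const_mul (1 / 2)
  have heq := tendsto_nhds_unique (hlim.congr' ?_) hlim2
  · rw [← heq, Finset.mul_sum]
    refine Finset.sum_congr rfl fun i _ => ?_
    rw [← integral_const_mul]
    refine integral_congr_ae (.of_forall fun x => ?_)
    simp only [zero_smul, add_zero]
    rw [integral_mul_const, integral_mollifier]
    ring
  · filter_upwards [self_mem_nhdsWithin] with r hr
    have h1 := sum_integral_cutField_mul_kern hΔ hr hR
    simp_rw [integral_kern_mul_laplacian_translate hu hΔ hexp hr, mul_neg, integral_neg] at h1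
    rw [Finset.sum_neg_distrib] at h1
    linarith

/-- The total curvature seen through the Pohozaev flux at infinity. -/
theorem tendsto_sum_integral_cutField {u : Plane → ℝ} (hu : ContDiff ℝ ∞ u)
    (hΔ : Integrable (Δ u)) (hexp : Integrable fun y => Real.exp (2 * u y)) :
    Filter.Tendsto (fun R : ℝ => ∑ i, ∫ x, cutField R x i * Δ u x * pd i u x) Filter.atTop
      (nhds ((∫ x, Δ u x) ^ 2 / (4 * Real.pi))) := by
  have h1 := (tendsto_integral_symKernel hΔ).const_mul (1 / (4 * Real.pi))
  rw [div_eq_mul_one_div, mul_comm]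
  refine h1.congr' ?_
  filter_upwards [Filter.eventually_gt_atTop 0] with R hR
  have h2 := integral_cutField_mul_pd hu hΔ hexp hR
  have := Real.pi_pos
  rw [one_div_mul_eq_div, div_eq_iff (by positivity)]
  linarith

/-! ### Pohozaev identities -/

/-- The divergence of `K V` for the cut-off identity field `V`. -/
theorem sum_pd_cutField_mul {K : Plane → ℝ} (hK : ContDiff ℝ ∞ K) (R : ℝ) (x : Plane) :
    ∑ i, pd i (fun x => cutField R x i * K x) x =
      (1 - trunc ((R⁻¹) ^ 2 * ‖x‖ ^ 2)) * inner ℝ x (∇ K x) +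
        2 * (1 - trunc ((R⁻¹) ^ 2 * ‖x‖ ^ 2) -
          (R⁻¹) ^ 2 * ‖x‖ ^ 2 * deriv trunc ((R⁻¹) ^ 2 * ‖x‖ ^ 2)) * K x := by
  set a := (R⁻¹) ^ 2
  have hq := contDiff_one_sub_trunc a
  have hd : deriv (fun s => 1 - trunc (a * s)) (‖x‖ ^ 2) = -(deriv trunc (a * ‖x‖ ^ 2) * a) := by
    have h1 : HasDerivAt (fun s => trunc (a * s)) (deriv trunc (a * ‖x‖ ^ 2) * (a * 1))
        (‖x‖ ^ 2) :=
      ((contDiff_trunc (n := 1)).differentiable one_ne_zero (a * ‖x‖ ^ 2)).hasDerivAt.comp _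
        ((hasDerivAt_id' (‖x‖ ^ 2)).const_mul a)
    rw [mul_one] at h1
    exact (h1.const_sub 1).deriv
  have h2 : ∀ i, pd i (fun x => cutField R x i * K x) x =
      cutField R x i * pd i K x + ((1 - trunc (a * ‖x‖ ^ 2)) -
        2 * (deriv trunc (a * ‖x‖ ^ 2) * a) * x i * x i) * K x := fun i => by
    have h3 : (fun x => cutField R x i) = fun x => (1 - trunc (a * ‖x‖ ^ 2)) * x i :=
      funext fun x => cutField_apply R x i
    rw [pd_mul _ (hK.differentiable (by simp) x), h3, pd_radial_mul_coord hq, hd]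
    · simp only [if_true]; ring
    · rw [h3]
      exact ((contDiff_radial hq).mul (contDiff_coord i)).differentiable one_ne_zero x
  simp_rw [h2, inner_gradient_eq_sum_pd, cutField_apply, Fin.sum_univ_two, sq_norm_plane]
  ring

theorem pd_exp_two_mul {u : Plane → ℝ} (hu : ContDiff ℝ ∞ u) (i : Fin 2) (x : Plane) :
    pd i (fun x => Real.exp (2 * u x)) x = 2 * Real.exp (2 * u x) * pd i u x := by
  have h1 := (hu.differentiable (by simp) x).hasFDerivAt
  have h2 := ((h1.const_mul 2).exp).fderiv
  unfold pd
  rw [h2]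
  simp
  ring

theorem exists_bound_cutoff_sub : ∃ B : ℝ, ∀ (R : ℝ) (x : Plane),
    |1 - trunc ((R⁻¹) ^ 2 * ‖x‖ ^ 2) -
      (R⁻¹) ^ 2 * ‖x‖ ^ 2 * deriv trunc ((R⁻¹) ^ 2 * ‖x‖ ^ 2)| ≤ B := by
  have hc : HasCompactSupport fun x : Plane => ‖x‖ ^ 2 * deriv trunc (‖x‖ ^ 2) :=
    (hasCompactSupport_radial deriv_trunc_of_ge).mul_left
  obtain ⟨B, hB⟩ := hc.exists_bound_of_continuous
    ((by fun_prop : Continuous fun x : Plane => ‖x‖ ^ 2).mul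
      (contDiff_deriv_trunc.continuous.comp (by fun_prop)))
  refine ⟨1 + B, fun R x => (abs_sub _ _).trans (add_le_add ?_ ?_)⟩
  · have h1 := trunc_nonneg ((R⁻¹) ^ 2 * ‖x‖ ^ 2)
    have h2 := trunc_le_one ((R⁻¹) ^ 2 * ‖x‖ ^ 2)
    rw [abs_le]; constructor <;> linarith
  · have := hB (R⁻¹ • x)
    simpa only [norm_smul, mul_pow, Real.norm_eq_abs, sq_abs] using this

/-- The local Pohozaev identity for `-Δ u = K e^{2u}`. -/
theorem sum_integral_cutField_eq {u K : Plane → ℝ} (hu : ContDiff ℝ ∞ u) (hK : ContDiff ℝ ∞ K)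
    (heq : ∀ x, -(Δ u x) = K x * Real.exp (2 * u x))
    (hcurv : Integrable fun x => K x * Real.exp (2 * u x)) {R : ℝ} (hR : 0 < R) :
    ∑ i, ∫ x, cutField R x i * Δ u x * pd i u x =
      (1 / 2) * (∫ x, (1 - trunc ((R⁻¹) ^ 2 * ‖x‖ ^ 2)) *
        (inner ℝ x (∇ K x) * Real.exp (2 * u x))) +
      ∫ x, (1 - trunc ((R⁻¹) ^ 2 * ‖x‖ ^ 2) -
          (R⁻¹) ^ 2 * ‖x‖ ^ 2 * deriv trunc ((R⁻¹) ^ 2 * ‖x‖ ^ 2)) *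
        (K x * Real.exp (2 * u x)) := by
  have hE : ContDiff ℝ ∞ fun x => Real.exp (2 * u x) := (contDiff_const.mul hu).exp
  have hVK : ∀ i, ContDiff ℝ 1 fun x => cutField R x i * K x := fun i =>
    ((contDiff_coord i).comp (contDiff_cutField R)).mul (hK.of_le (by simp))
  have hVc : ∀ i, HasCompactSupport fun x => cutField R x i * K x := fun i => by
    refine ((hasCompactSupport_cutField hR).mono fun x hx => ?_)
    contrapose! hx
    simp only [Function.mem_support, not_not] at hx
    simp [hx]
  have hpdc : ∀ i, HasCompactSupport (pd i fun x => cutField R x i * K x) := fun i => by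
    refine ((hVc i).fderiv (𝕜 := ℝ)).mono fun x hx => ?_
    contrapose! hx
    simp only [Function.mem_support, not_not] at hx
    simp [pd, hx]
  -- By the equation, `Δu ∂ᵢu = -½ K ∂ᵢ(e^{2u})`; the derivative then moves onto `K V`.
  have hterm : ∀ i, ∫ x, cutField R x i * Δ u x * pd i u x =
      (1 / 2) * ∫ x, pd i (fun x => cutField R x i * K x) x * Real.exp (2 * u x) := fun i => by
    have h1 := integral_mul_pd (hVK i) (hVc i) (hE.of_le (by simp)) i
    rw [eq_neg_iff_add_eq_zero, add_comm, ← eq_neg_iff_add_eq_zero] at h1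
    rw [h1, ← integral_neg, ← integral_const_mul]
    refine integral_congr_ae (.of_forall fun x => ?_)
    simp only [pd_exp_two_mul hu]
    rw [show Δ u x = -(K x * Real.exp (2 * u x)) by rw [← heq, neg_neg]]
    ring
  have hcη : Continuous fun x : Plane => 1 - trunc ((R⁻¹) ^ 2 * ‖x‖ ^ 2) :=
    (contDiff_radial (contDiff_one_sub_trunc _)).continuous
  have hgc : Continuous fun x => inner ℝ x (∇ K x) := by
    simp_rw [inner_gradient_eq_sum_pd]
    exact continuous_finsetSum _ fun i _ =>
      (contDiff_coord (n := 0) i).continuous.mul (hK.pd i).continuous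
  have hi1 : Integrable fun x : Plane => (1 - trunc ((R⁻¹) ^ 2 * ‖x‖ ^ 2)) *
      (inner ℝ x (∇ K x) * Real.exp (2 * u x)) :=
    (hcη.mul (hgc.mul hE.continuous)).integrable_of_hasCompactSupport
      (hasCompactSupport_cutoff hR).mul_right
  have hi2 : ∀ i, Integrable fun x => pd i (fun x => cutField R x i * K x) x *
      Real.exp (2 * u x) := fun i =>
    (((hVK i).continuous_pd one_ne_zero i).mul hE.continuous).integrable_of_hasCompactSupport
      (hpdc i).mul_right
  simp_rw [hterm]
  rw [← Finset.mul_sum, ← integral_finsetSum _ fun i _ => hi2 i]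
  set h : Plane → ℝ := fun x => 1 - trunc ((R⁻¹) ^ 2 * ‖x‖ ^ 2) -
    (R⁻¹) ^ 2 * ‖x‖ ^ 2 * deriv trunc ((R⁻¹) ^ 2 * ‖x‖ ^ 2) with hh
  have hsplit : ∀ x, ∑ i, pd i (fun x => cutField R x i * K x) x * Real.exp (2 * u x) =
      (1 - trunc ((R⁻¹) ^ 2 * ‖x‖ ^ 2)) * (inner ℝ x (∇ K x) * Real.exp (2 * u x)) +
        2 * (h x * (K x * Real.exp (2 * u x))) := fun x => by
    rw [← Finset.sum_mul, sum_pd_cutField_mul hK]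
    simp only [hh]
    ring
  have hi3 : Integrable fun x => h x * (K x * Real.exp (2 * u x)) := by
    obtain ⟨B, hB⟩ := exists_bound_cutoff_sub
    refine hcurv.bdd_mul (Continuous.aestronglyMeasurable ?_) (.of_forall fun x => hB R x)
    exact hcη.sub ((continuous_const.mul (by fun_prop)).mul
      (contDiff_deriv_trunc.continuous.comp (by fun_prop)))
  rw [integral_congr_ae (.of_forall hsplit), integral_add hi1 (hi3.const_mul 2),
    integral_const_mul]
  ring

theorem tendsto_inv_sq_mul (c : ℝ) :
    Filter.Tendsto (fun R : ℝ => (R⁻¹) ^ 2 * c) Filter.atTop (nhds 0) := by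
  simpa using (tendsto_inv_atTop_zero (𝕜 := ℝ)).pow 2 |>.mul_const c

/-- The global Pohozaev identity. -/
theorem tendsto_integral_cutoff_mul_inner {u K : Plane → ℝ} (hu : ContDiff ℝ ∞ u)
    (hK : ContDiff ℝ ∞ K) (heq : ∀ x, -(Δ u x) = K x * Real.exp (2 * u x))
    (hcurv : Integrable fun x => K x * Real.exp (2 * u x))
    (hvol : Integrable fun x => Real.exp (2 * u x)) :
    Filter.Tendsto (fun R : ℝ => ∫ x, (1 - trunc ((R⁻¹) ^ 2 * ‖x‖ ^ 2)) *
        (inner ℝ x (∇ K x) * Real.exp (2 * u x))) Filter.atTop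
      (nhds (2 * ((∫ x, K x * Real.exp (2 * u x)) ^ 2 / (4 * Real.pi) -
        ∫ x, K x * Real.exp (2 * u x)))) := by
  have hΔeq : Δ u = fun x => -(K x * Real.exp (2 * u x)) := funext fun x => by
    rw [← heq, neg_neg]
  have hΔ : Integrable (Δ u) := by rw [hΔeq]; exact hcurv.neg
  have h1 := tendsto_sum_integral_cutField hu hΔ hvol
  rw [show ∫ x, Δ u x = -∫ x, K x * Real.exp (2 * u x) by rw [hΔeq, integral_neg], neg_sq] at h1
  have hcη : ∀ R : ℝ, Continuous fun x : Plane => 1 - trunc ((R⁻¹) ^ 2 * ‖x‖ ^ 2) := fun R =>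
    (contDiff_radial (contDiff_one_sub_trunc _)).continuous
  have h2 : Filter.Tendsto (fun R : ℝ => ∫ x, (1 - trunc ((R⁻¹) ^ 2 * ‖x‖ ^ 2) -
          (R⁻¹) ^ 2 * ‖x‖ ^ 2 * deriv trunc ((R⁻¹) ^ 2 * ‖x‖ ^ 2)) *
        (K x * Real.exp (2 * u x))) Filter.atTop (nhds (∫ x, K x * Real.exp (2 * u x))) := by
    obtain ⟨B, hB⟩ := exists_bound_cutoff_sub
    refine tendsto_integral_filter_of_dominated_convergence
      (fun x => B * |K x * Real.exp (2 * u x)|) (.of_forall fun R => ?_)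
      (.of_forall fun R => .of_forall fun x => ?_) (hcurv.abs.const_mul B)
      (.of_forall fun x => ?_)
    · refine Continuous.aestronglyMeasurable ?_
      exact ((hcη R).sub ((continuous_const.mul (by fun_prop)).mul
        (contDiff_deriv_trunc.continuous.comp (by fun_prop)))).mul
          (hK.continuous.mul (contDiff_const.mul hu).exp.continuous)
    · rw [norm_mul]
      exact mul_le_mul_of_nonneg_right (hB R x) (norm_nonneg _)
    · have hc : Continuous fun s => 1 - trunc s - s * deriv trunc s :=
        (continuous_const.sub continuous_trunc).sub
          (continuous_id.mul contDiff_deriv_trunc.continuous)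
      have h3 := ((hc.tendsto' 0 1 (by simp [trunc_zero])).comp
        (tendsto_inv_sq_mul (‖x‖ ^ 2))).mul_const (K x * Real.exp (2 * u x))
      rw [one_mul] at h3
      exact h3
  -- Integrability of `x · ∇K e^{2u}` is not assumed, so its cut-off integral is obtained as a
  -- difference of two convergent quantities.
  refine ((h1.sub h2).const_mul 2).congr' ?_
  filter_upwards [Filter.eventually_gt_atTop 0] with R hR
  rw [sum_integral_cutField_eq hu hK heq hcurv hR]
  ring

/-! ### The equality case and the conclusion -/

theorem trunc_monotone : Monotone trunc := fun s t hst =>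
  Real.smoothTransition.monotone (by linarith)

/-- The cut-offs increase with `R` and `h ≥ 0`, so a positive integral at one scale bounds all later
ones from below and prevents the limit `0`. -/
theorem eq_zero_of_tendsto_integral_cutoff {h : Plane → ℝ} (hc : Continuous h)
    (hn : ∀ x, 0 ≤ h x) (hlim : Filter.Tendsto (fun R : ℝ =>
      ∫ x, (1 - trunc ((R⁻¹) ^ 2 * ‖x‖ ^ 2)) * h x) Filter.atTop (nhds 0)) (x : Plane) :
    h x = 0 := by
  by_contra hx
  have hηc : ∀ R : ℝ, Continuous fun x : Plane => (1 - trunc ((R⁻¹) ^ 2 * ‖x‖ ^ 2)) * h x :=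
    fun R => (contDiff_radial (contDiff_one_sub_trunc _)).continuous.mul hc
  have hηs : ∀ R : ℝ, 0 < R → HasCompactSupport
      fun x : Plane => (1 - trunc ((R⁻¹) ^ 2 * ‖x‖ ^ 2)) * h x := fun R hR =>
    (hasCompactSupport_cutoff hR).mul_right
  obtain ⟨S, hS, hS0⟩ := (((tendsto_inv_sq_mul (‖x‖ ^ 2)).eventually
    (gt_mem_nhds (show (0 : ℝ) < 1 / 2 by norm_num))).and (Filter.eventually_gt_atTop 0)).exists
  have hpos : 0 < ∫ x, (1 - trunc ((S⁻¹) ^ 2 * ‖x‖ ^ 2)) * h x := by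
    refine (hηc S).integral_pos_of_hasCompactSupport_nonneg_nonzero (x := x) (hηs S hS0)
      (fun y => mul_nonneg (sub_nonneg.2 (trunc_le_one _)) (hn y)) ?_
    rw [trunc_of_le hS.le]
    simpa using hx
  refine absurd (ge_of_tendsto hlim ?_) (not_le.2 hpos)
  filter_upwards [Filter.eventually_ge_atTop S] with R hR
  have hR0 := hS0.trans_le hR
  refine integral_mono ((hηc S).integrable_of_hasCompactSupport (hηs S hS0))
    ((hηc R).integrable_of_hasCompactSupport (hηs R hR0)) fun y => ?_
  refine mul_le_mul_of_nonneg_right (sub_le_sub_left (trunc_monotone ?_) 1) (hn y)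
  gcongr

/-- Along `t ↦ K (t • x)` the hypothesis says that `t` times the derivative vanishes. Continuity of
the derivative covers `t = 0`, so `K` is constant along the line through `0` and `x`. -/
theorem eq_apply_zero_of_inner_gradient_eq_zero {K : Plane → ℝ} (hK : ContDiff ℝ ∞ K)
    (h : ∀ x, inner ℝ x (∇ K x) = 0) (x : Plane) : K x = K 0 := by
  have hd : ∀ t : ℝ, HasDerivAt (fun t : ℝ => K (t • x)) (fderiv ℝ K (t • x) x) t := fun t =>
    (hK.differentiable (by simp) (t • x)).hasFDerivAt.comp_hasDerivAt t
      (by simpa using (hasDerivAt_id t).smul_const x)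
  have hc : Continuous fun t : ℝ => fderiv ℝ K (t • x) x :=
    ((hK.continuous_fderiv (by simp)).comp (by fun_prop)).clm_apply continuous_const
  have h0 : (fun t : ℝ => fderiv ℝ K (t • x) x) = fun _ => 0 := by
    refine hc.ext_on (dense_compl_singleton (0 : ℝ)) continuous_const fun t ht => ?_
    have h1 := h (t • x)
    rw [inner_gradient_eq_sum_pd, ← fderiv_apply_eq_sum_pd, map_smul, smul_eq_mul] at h1
    exact (mul_eq_zero.1 h1).resolve_left ht
  have := is_const_of_deriv_eq_zero (fun t => (hd t).differentiableAt)
    (fun t => (hd t).deriv.trans (congrFun h0 t)) 1 0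
  simpa using this

theorem mainTheorem9
    (u K : EuclideanSpace ℝ (Fin 2) → ℝ)
    (hu : ContDiff ℝ ∞ u) (hK : ContDiff ℝ ∞ K)
    (heq : ∀ x, -(Δ u x) = K x * Real.exp (2 * u x))
    (hcurv : Integrable (fun x => K x * Real.exp (2 * u x)) volume)
    (hvol : Integrable (fun x => Real.exp (2 * u x)) volume)
    (hgrad : ∀ x, 0 ≤ inner ℝ x (∇ K x))
    (hinf : ∃ R : ℝ, ∀ x, R ≤ ‖x‖ → 0 ≤ K x) :
    4 * Real.pi ≤ ∫ x, K x * Real.exp (2 * u x) ∧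
      ((∫ x, K x * Real.exp (2 * u x)) = 4 * Real.pi ↔ ∃ c : ℝ, 0 < c ∧ ∀ x, K x = c) := by
  have hΔeq : Δ u = fun x => -(K x * Real.exp (2 * u x)) := funext fun x => by
    rw [← heq, neg_neg]
  have hΔ : Integrable (Δ u) := by rw [hΔeq]; exact hcurv.neg
  have hpi := Real.pi_pos
  have hpos : 0 < ∫ x, K x * Real.exp (2 * u x) := by
    have := integral_neg_laplacian_pos hu hΔ hvol
    rw [hΔeq, integral_neg] at this
    linarith
  have hlim := tendsto_integral_cutoff_mul_inner hu hK heq hcurv hvol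
  set Λ := ∫ x, K x * Real.exp (2 * u x) with hΛ
  -- The factored form shows the sign: since `Λ > 0`, a non-negative limit means `4π ≤ Λ`, and a
  -- zero limit means `Λ = 4π`.
  have hval : 2 * (Λ ^ 2 / (4 * Real.pi) - Λ) = Λ * (Λ - 4 * Real.pi) / (2 * Real.pi) := by
    field_simp
    ring
  rw [hval] at hlim
  have hnn : ∀ x, 0 ≤ inner ℝ x (∇ K x) * Real.exp (2 * u x) := fun x =>
    mul_nonneg (hgrad x) (Real.exp_pos _).le
  refine ⟨?_, fun hΛeq => ?_, fun ⟨c, hc, hKc⟩ => ?_⟩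
  · have h1 := ge_of_tendsto' hlim fun R => integral_nonneg fun x =>
      mul_nonneg (sub_nonneg.2 (trunc_le_one _)) (hnn x)
    rw [le_div_iff₀ (by positivity), zero_mul] at h1
    linarith [nonneg_of_mul_nonneg_right h1 hpos]
  · rw [hΛeq, sub_self, mul_zero, zero_div] at hlim
    have hgc : Continuous fun x => inner ℝ x (∇ K x) * Real.exp (2 * u x) := by
      simp_rw [inner_gradient_eq_sum_pd]
      exact (continuous_finsetSum _ fun i _ => (contDiff_coord (n := 0) i).continuous.mul
        (hK.pd i).continuous).mul (contDiff_const.mul hu).exp.continuous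
    have hz := eq_zero_of_tendsto_integral_cutoff hgc hnn hlim
    have hconst := eq_apply_zero_of_inner_gradient_eq_zero hK fun x =>
      (mul_eq_zero.1 (hz x)).resolve_right (Real.exp_pos _).ne'
    refine ⟨K 0, ?_, hconst⟩
    -- A non-positive constant would make the total curvature non-positive.
    by_contra! hneg
    refine absurd hpos (not_lt.2 (integral_nonpos fun x => ?_))
    simp only [hconst x]
    exact mul_nonpos_of_nonpos_of_nonneg hneg (Real.exp_pos _).le
  · have hK' : K = fun _ => c := funext hKc
    have h0 : ∀ x, inner ℝ x (∇ K x) = 0 := fun x => by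
      rw [inner_gradient_eq_sum_pd, ← fderiv_apply_eq_sum_pd, hK']
      simp
    simp_rw [h0, zero_mul, mul_zero, integral_zero] at hlim
    have h1 := tendsto_nhds_unique hlim tendsto_const_nhds
    rw [div_eq_zero_iff] at h1
    rcases h1 with h1 | h1
    · rcases mul_eq_zero.1 h1 with h2 | h2 <;> linarith
    · linarith
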